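/- Let $k$ be a number field and let $r\ge 2$ be an integer. For integers $s,n\ge 2$ and $\alpha=(\alpha_0,\dots,\alpha_n)\in k^{n+1}$ with $\alpha_0^r,\dots,\alpha_n^r$ pairwise distinct (call such $\alpha$ admissible), let $\mathcal X_{\alpha}\subset\mathbb P^n_k$ be the closed subscheme, with homogeneous coordinates $Y_0,\dots,Y_n$, defined by the $n-1$ equations $$(\alpha_i^r-\alpha_1^r)Y_0^s+(\alpha_0^r-\alpha_i^r)Y_1^s+(\alpha_1^r-\alpha_0^r)Y_i^s=0\qquad(i=2,\dots,n).$$ It depends on $\alpha$ only through the point $[\alpha_0:\dots:\alpha_n]\in\mathbb P^n(k)$. 1. Let $s=2$, $n=2$. For every admissible $\alpha\in k^3$, $\mathcal X_{\alpha}$ is a smooth, geometrically irreducible conic (a curve of genus $0$) over $k$ that contains the $k$-rational point $[1:1:1]$, and it has infinitely many $k$-rational points. 2. Let $s=2$, $n=3$. For every admissible $\alpha\in k^4$, $\mathcal X_{\alpha}$ is a smooth, geometrically irreducible projective curve of genus one over $k$. There are infinitely many points $[\alpha_0:\alpha_1:\alpha_2:\alpha_3]\in\mathbb P^3(k)$ with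 $\alpha$ admissible for which $\mathcal X_{\alpha}$ is an elliptic curve over $k$ (that is, isomorphic over $k$ to a Weierstrass cubic of nonzero discriminant) whose group of $k$-rational points has rank at least $1$. 3. Let $s=3$, $n=2$. For every admissible $\alpha\in k^3$, $\mathcal X_{\alpha}$ is a smooth, geometrically irreducible projective curve of genus one over $k$. There are infinitely many points $[\alpha_0:\alpha_1:\alpha_2]\in\mathbb P^2(k)$ with $\alpha$ admissible for which $\mathcal X_{\alpha}$ is an elliptic curve over $k$ whose group of $k$-rational points has rank at least $1$. -/

import Mathlib

open scoped LinearAlgebra.Projectivization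

noncomputable section

namespace LowGenusFibers

variable {k : Type*} [Field k] {σ τ : Type*}

/-- The `L`-rational points of the closed subscheme of the projective space with homogeneous
coordinates indexed by `σ` that is cut out by the homogeneous ideal `I` of `k[Y_i : i ∈ σ]`.
(For a homogeneous ideal the condition does not depend on the representative vector.) -/
def points (I : Ideal (MvPolynomial σ k)) (L : Type*) [Field L] [Algebra k L] :
    Set (ℙ L (σ → L)) :=
  {P | ∀ f ∈ I, MvPolynomial.aeval P.rep f = 0}

/-- The Hilbert function of `I`: the dimension of the degree `m` part of `k[Y_i : i ∈ σ] / I`. -/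
def hilbertFunction (I : Ideal (MvPolynomial σ k)) (m : ℕ) : ℕ :=
  Module.finrank k
    ((MvPolynomial.homogeneousSubmodule σ k m).map (Ideal.Quotient.mkₐ k I).toLinearMap)

/-- The gradient of `f` at the vector `v`. -/
def gradient {L : Type*} [Field L] [Algebra k L] (v : σ → L) (f : MvPolynomial σ k) : σ → L :=
  fun j => MvPolynomial.aeval v (MvPolynomial.pderiv j f)

/-- `I` is a homogeneous ideal that defines a smooth, geometrically irreducible projective curve
of genus `g` over `k`:
* the zero locus of `I` over the algebraic closure is irreducible;
* the Jacobian criterion holds at every geometric point: in the projective space of dimension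
  `#σ - 1` the Jacobian matrix of `I` has rank `#σ - 2`;
* the Hilbert polynomial is `d * m + 1 - g` with `d > 0`: the dimension is one, the degree is `d`,
  and the arithmetic genus, which is the genus since the curve is smooth, is `g`. -/
structure IsSmoothCurveOfGenus [Fintype σ] (I : Ideal (MvPolynomial σ k)) (g : ℕ) : Prop where
  homogeneous : ∀ f ∈ I, ∀ m : ℕ, MvPolynomial.homogeneousComponent m f ∈ I
  geometrically_irreducible :
    (I.map (MvPolynomial.map (algebraMap k (AlgebraicClosure k)))).radical.IsPrime
  smooth : ∀ P ∈ points I (AlgebraicClosure k),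
    Module.finrank (AlgebraicClosure k)
      (Submodule.span (AlgebraicClosure k) (gradient P.rep '' (I : Set (MvPolynomial σ k)))) + 2
        = Fintype.card σ
  hilbert_polynomial : ∃ d : ℕ, 0 < d ∧ ∃ m₀ : ℕ, ∀ m : ℕ, m₀ ≤ m →
    (hilbertFunction I m : ℤ) = d * m + 1 - g

/-- A map between the geometric points of two projective varieties over `k` is a morphism over `k`
if, around each point, it is given by forms of the same degree with coefficients in `k`. -/
def IsMorphism {I : Ideal (MvPolynomial σ k)} {J : Ideal (MvPolynomial τ k)}
    (φ : points I (AlgebraicClosure k) → points J (AlgebraicClosure k)) : Prop :=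
  ∀ P : points I (AlgebraicClosure k), ∃ (d : ℕ) (F : τ → MvPolynomial σ k),
    (∀ j, (F j).IsHomogeneous d) ∧
    (fun j => MvPolynomial.aeval P.1.rep (F j)) ≠ 0 ∧
    ∀ (Q : points I (AlgebraicClosure k))
      (hQ : (fun j => MvPolynomial.aeval Q.1.rep (F j)) ≠ 0),
      (φ Q : ℙ (AlgebraicClosure k) (τ → AlgebraicClosure k)) =
        Projectivization.mk (AlgebraicClosure k) (fun j => MvPolynomial.aeval Q.1.rep (F j)) hQ

/-- Isomorphism over `k` of the projective varieties over `k` defined by `I` and `J`. -/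
def IsIsomorphic (I : Ideal (MvPolynomial σ k)) (J : Ideal (MvPolynomial τ k)) : Prop :=
  ∃ φ : points I (AlgebraicClosure k) ≃ points J (AlgebraicClosure k),
    IsMorphism φ ∧ IsMorphism φ.symm

open Classical in
/-- The ideal `I` defines a smooth projective curve of genus one that is an elliptic curve over `k` whose group of
`k`-rational points has rank at least one: it is isomorphic over `k` to the projective plane curve
given by a Weierstrass equation with nonzero discriminant, and the Mordell-Weil group of the latter
has rank at least one. (The rank does not depend on the choice of the origin or of the
isomorphism.) -/
def IsEllipticCurveOfPositiveRank [Fintype σ] (I : Ideal (MvPolynomial σ k)) : Prop :=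
  IsSmoothCurveOfGenus I 1 ∧ ∃ E : WeierstrassCurve k, E.IsElliptic ∧
    IsIsomorphic I (Ideal.span {E.toProjective.polynomial}) ∧
    1 ≤ Module.rank ℤ E.toAffine.Point

/-- The ideal is generated by a single nonzero quadratic form in three variables. -/
def IsConic (I : Ideal (MvPolynomial (Fin 3) k)) : Prop :=
  ∃ q : MvPolynomial (Fin 3) k, q ≠ 0 ∧ q.IsHomogeneous 2 ∧ I = Ideal.span {q}

/-- The admissible tuples `(α_0, …, α_n)`: the powers `α_i ^ r` are pairwise distinct. -/
def IsAdmissible (r : ℕ) {n : ℕ} (α : Fin (n + 1) → k) : Prop :=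
  ∀ i j, i ≠ j → α i ^ r ≠ α j ^ r

/-- The form
`(α_i^r - α_1^r) Y_0^s + (α_0^r - α_i^r) Y_1^s + (α_1^r - α_0^r) Y_i^s`. -/
def fiberForm (r s : ℕ) {n : ℕ} (α : Fin (n + 1) → k) (i : Fin (n + 1)) :
    MvPolynomial (Fin (n + 1)) k :=
  MvPolynomial.C (α i ^ r - α 1 ^ r) * MvPolynomial.X 0 ^ s +
    MvPolynomial.C (α 0 ^ r - α i ^ r) * MvPolynomial.X 1 ^ s +
    MvPolynomial.C (α 1 ^ r - α 0 ^ r) * MvPolynomial.X i ^ s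

/-- The homogeneous ideal of the fiber over `(α_0, …, α_n)`: it is generated by the `n - 1` forms
`fiberForm r s α i` with `i = 2, …, n`. -/
def fiberIdeal (r s : ℕ) {n : ℕ} (α : Fin (n + 1) → k) : Ideal (MvPolynomial (Fin (n + 1)) k) :=
  Ideal.span {f | ∃ i : Fin (n + 1), 2 ≤ (i : ℕ) ∧ f = fiberForm r s α i}

/-- The points `[α_0 : … : α_n]` of projective space over `k`, with `α` admissible, over which the
fiber is an elliptic curve of rank at least one over `k`. (The fiber and admissibility are
unchanged when `α` is multiplied by a nonzero scalar.) -/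
def positiveRankLocus (k : Type*) [Field k] (r s n : ℕ) : Set (ℙ k (Fin (n + 1) → k)) :=
  {a | ∃ (α : Fin (n + 1) → k) (hα : α ≠ 0), a = Projectivization.mk k α hα ∧
    IsAdmissible r α ∧ IsEllipticCurveOfPositiveRank (fiberIdeal r s α)}

end LowGenusFibers

end

/-!
The fibers are diagonal curves: `A X₀^s + B X₁^s + D X₂^s = 0` in the plane, and an intersection of
two diagonal quadrics in `ℙ³`.

*Smoothness, irreducibility, genus.* The Jacobian criterion is immediate for diagonal equations. A
ternary diagonal form is irreducible by Eisenstein's criterion at the prime ideal of a smooth point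
of the binary form `B X₁^s + D X₂^s` (`irreducible_of_smooth_zero`, `prime_diagonal`); this suffices
for the plane curves. For two quadrics, the conic that the first one defines is parametrized by
binary quadratic forms over the algebraic closure, so that the curve is the image of a double cover
`w² = q(u, v)` of the line; the radical of its ideal is the preimage of a principal prime ideal, by
the Nullstellensatz (`isPrime_radical_span_pair`). The Hilbert functions are those of a hypersurface
and of a complete intersection (`hilbertFunction_span_singleton`, `hilbertFunction_span_pair`); they
give the genera `(s - 1) (s - 2) / 2` and `1`.

*Rational points of the conic.* All diagonal equations above have the point `[1 : … : 1]`; on the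
conic, the pencil of lines through a rational point gives infinitely many others
(`infinite_points_conic`).

*The Jacobians.* With `a, b, c` the first three `α_i^r`, and `α₃^r = 0`, the intersection of
quadrics is isomorphic to `y² = (x + a b) (x + b c) (x + c a)` (`isIsomorphic_quadricJacobian`). The
cubic `a X³ + b Y³ + c Z³ = 0` with `a + b + c = 0` is isomorphic to `y² = x³ + t² - e³`, where
`e = -(a b + b c + c a)` and `t = -(a - b) (b - c) (c - a) / 2` (`isIsomorphic_cubicJacobian`). Both
isomorphisms use the slope `m` of the lines through a known rational point, `(0, -a b c)` and
`(e, -t)` respectively. The functions `1, m, m², x`, respectively `1, m, x`, embed the Weierstrass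
cubic in space, respectively in the plane, and the relation between `m` and `x` becomes diagonal in
suitable linear coordinates.

*Positive rank.* At a place `v` above `2`, doubling enlarges a nonintegral `x`-coordinate on
`y² = x³ + a₂ x² + a₄ x + a₆` with integral coefficients
(`valuation_lt_valuation_double`), so a point with nonintegral `x`-coordinate has infinite order. The
double of the known point has such an `x`-coordinate if `a + b + c` is odd, respectively if `e` is
odd and `t` is integral, because the slope of the tangent then has a denominator that is divisible
by `2`. Both conditions hold over the rational points `[1 : 2 : 2 m + 4 : 0]`, respectively
`[0 : 1 : 2 m + 4]`.
-/

noncomputable section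

namespace LowGenusFibers

open MvPolynomial

/-! ### Ideals generated by forms -/

section Generators

variable {k : Type*} [Field k] {σ τ : Type*}

lemma aeval_smul_of_isHomogeneous {L : Type*} [Field L] [Algebra k L] {f : MvPolynomial σ k}
    {n : ℕ} (hf : f.IsHomogeneous n) (c : L) (v : σ → L) :
    aeval (c • v) f = c ^ n * aeval v f := by
  rw [aeval_def, aeval_def, eval₂_eq, eval₂_eq, Finset.mul_sum]
  refine Finset.sum_congr rfl fun d hd => ?_
  have hdeg : ∑ i ∈ d.support, d i = n := by
    simpa [Finsupp.degree] using hf.degree_eq_sum_deg_support hd |>.symm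
  simp only [Pi.smul_apply, smul_eq_mul, mul_pow, Finset.prod_mul_distrib]
  rw [Finset.prod_pow_eq_pow_sum, hdeg]
  ring

lemma aeval_eq_zero_of_mem_span {L : Type*} [Field L] [Algebra k L] {S : Set (MvPolynomial σ k)}
    {v : σ → L} (hv : ∀ f ∈ S, aeval v f = 0) {f : MvPolynomial σ k} (hf : f ∈ Ideal.span S) :
    aeval v f = 0 := by
  have h : v ∈ zeroLocus L (Ideal.span S) := by
    rw [zeroLocus_span]
    exact hv
  exact h f hf

lemma mk_mem_points_iff {L : Type*} [Field L] [Algebra k L] {S : Set (MvPolynomial σ k)}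
    (hS : ∀ f ∈ S, ∃ n, f.IsHomogeneous n) (v : σ → L) (hv : v ≠ 0) :
    Projectivization.mk L v hv ∈ points (Ideal.span S) L ↔ ∀ f ∈ S, aeval v f = 0 := by
  obtain ⟨a, ha⟩ := Projectivization.exists_smul_eq_mk_rep L v hv
  have key : ∀ f ∈ S, (aeval (Projectivization.mk L v hv).rep f = 0 ↔ aeval v f = 0) := by
    intro f hf
    obtain ⟨n, hn⟩ := hS f hf
    rw [← ha, Units.smul_def, aeval_smul_of_isHomogeneous hn]
    simp
  constructor
  · exact fun h f hf => (key f hf).1 (h f (Ideal.subset_span hf))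
  · exact fun h f hf => aeval_eq_zero_of_mem_span (fun g hg => (key g hg).2 (h g hg)) hf

lemma homogeneousComponent_mem_span {S : Set (MvPolynomial σ k)}
    (hS : ∀ f ∈ S, ∃ n, f.IsHomogeneous n) {f : MvPolynomial σ k} (hf : f ∈ Ideal.span S) (m : ℕ) :
    homogeneousComponent m f ∈ Ideal.span S := by
  let _ : GradedAlgebra (homogeneousSubmodule σ k) := MvPolynomial.gradedAlgebra
  have h : (Ideal.span S).IsHomogeneous (homogeneousSubmodule σ k) :=
    Ideal.homogeneous_span _ _ fun x hx => hS x hx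
  exact homogeneousComponent_mem_of_mem h hf m

/-- At a zero of the generators, the Leibniz rule reduces the gradients of all elements of the
ideal to those of the generators. -/
lemma span_gradient_image_span {L : Type*} [Field L] [Algebra k L] {S : Set (MvPolynomial σ k)}
    {v : σ → L} (hv : ∀ f ∈ S, aeval v f = 0) :
    Submodule.span L (gradient v '' (Ideal.span S : Set (MvPolynomial σ k))) =
      Submodule.span L (gradient v '' S) := by
  apply le_antisymm
  · rw [Submodule.span_le]
    rintro _ ⟨f, hf, rfl⟩
    induction hf using Submodule.span_induction with
    | mem x hx => exact Submodule.subset_span ⟨x, hx, rfl⟩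
    | zero =>
      have : gradient v (0 : MvPolynomial σ k) = 0 := by ext; simp [gradient]
      rw [this]
      exact zero_mem _
    | add x y _ _ hx hy =>
      have : gradient v (x + y) = gradient v x + gradient v y := by ext; simp [gradient]
      rw [this]
      exact add_mem hx hy
    | smul a x hx hx' =>
      have : gradient v (a • x) = (aeval v a : L) • gradient v x := by
        ext j
        have h0 : aeval v x = 0 := aeval_eq_zero_of_mem_span hv hx
        simp [gradient, Derivation.leibniz, h0]
      rw [this]
      exact Submodule.smul_mem _ _ hx'
  · exact Submodule.span_mono (Set.image_mono Ideal.subset_span)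

end Generators

/-! ### Hilbert functions of hypersurfaces and complete intersections -/

section Hilbert

variable {k : Type*} [Field k] {σ : Type*}

lemma finrank_homogeneousSubmodule [Fintype σ] (m : ℕ) :
    Module.finrank k (homogeneousSubmodule σ k m) = (Fintype.card σ + m - 1).choose m := by
  classical
  have hset : {d : σ →₀ ℕ | d.degree = m} =
      ((Finset.univ.finsuppAntidiag m : Finset (σ →₀ ℕ)) : Set (σ →₀ ℕ)) := by
    ext d
    simp [Finset.mem_finsuppAntidiag, Finsupp.degree_eq_sum]
  rw [homogeneousSubmodule_eq_finsupp_supported,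
    (AddMonoidAlgebra.supportedEquivFinsupp {d : σ →₀ ℕ | d.degree = m}).finrank_eq]
  rw [hset, Module.finrank_finsupp_self]
  simp [Finset.card_finsuppAntidiag_nat_eq_choose]

instance [Finite σ] (m : ℕ) : FiniteDimensional k (homogeneousSubmodule σ k m) :=
  Module.Finite.iff_fg.2 (homogeneousSubmodule_fg σ k m)

lemma hilbertFunction_add_finrank [Finite σ] (I : Ideal (MvPolynomial σ k)) (m : ℕ) :
    hilbertFunction I m +
      Module.finrank k (homogeneousSubmodule σ k m ⊓ I.restrictScalars k :
        Submodule k (MvPolynomial σ k)) = Module.finrank k (homogeneousSubmodule σ k m) := by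
  have h := LinearMap.finrank_range_add_finrank_ker
    ((Ideal.Quotient.mkₐ k I).toLinearMap.domRestrict (homogeneousSubmodule σ k m))
  rw [LinearMap.range_domRestrict] at h
  rw [hilbertFunction, ← h]
  congr 1
  rw [LinearMap.ker_domRestrict]
  have hk : LinearMap.ker (Ideal.Quotient.mkₐ k I).toLinearMap = I.restrictScalars k := by
    ext x
    simp [Ideal.Quotient.eq_zero_iff_mem]
  rw [hk, ← Submodule.finrank_map_subtype_eq, Submodule.map_comap_subtype]

lemma homogeneousComponent_mul {f : MvPolynomial σ k} {s m : ℕ} (hf : f.IsHomogeneous s)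
    (hs : s ≤ m) (g : MvPolynomial σ k) :
    homogeneousComponent m (f * g) = f * homogeneousComponent (m - s) g := by
  let _ : GradedAlgebra (homogeneousSubmodule σ k) := MvPolynomial.gradedAlgebra
  have hd : ∀ (x : MvPolynomial σ k) (i : ℕ),
      (DirectSum.decompose (homogeneousSubmodule σ k) x i : MvPolynomial σ k) =
        homogeneousComponent i x := decomposition.decompose'_apply
  rw [← hd, ← hd]
  exact DirectSum.coe_decompose_mul_of_left_mem_of_le (homogeneousSubmodule σ k) hf hs

/-- The forms of degree `m` that are multiples of `f` by a form of degree `m - s`. -/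
def formMultiples (f : MvPolynomial σ k) (s m : ℕ) : Submodule k (MvPolynomial σ k) :=
  (homogeneousSubmodule σ k (m - s)).map (LinearMap.mulLeft k f)

lemma finrank_formMultiples {f : MvPolynomial σ k} (hf : f ≠ 0) (s m : ℕ) :
    Module.finrank k (formMultiples f s m) =
      Module.finrank k (homogeneousSubmodule σ k (m - s)) :=
  (Submodule.equivMapOfInjective _ (fun _ _ h => mul_left_cancel₀ hf h) _).finrank_eq.symm

lemma mem_formMultiples {f p : MvPolynomial σ k} {s m : ℕ} :
    p ∈ formMultiples f s m ↔ ∃ h : MvPolynomial σ k, h.IsHomogeneous (m - s) ∧ f * h = p :=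
  Iff.rfl

lemma homogeneousSubmodule_inf_span_pair {f g : MvPolynomial σ k} {s t m : ℕ}
    (hf : f.IsHomogeneous s) (hg : g.IsHomogeneous t) (hs : s ≤ m) (ht : t ≤ m) :
    homogeneousSubmodule σ k m ⊓ (Ideal.span {f, g}).restrictScalars k =
      formMultiples f s m ⊔ formMultiples g t m := by
  ext p
  rw [Submodule.mem_inf, Submodule.mem_sup, Submodule.restrictScalars_mem, Ideal.mem_span_pair,
    mem_homogeneousSubmodule]
  constructor
  · rintro ⟨hp, a, b, rfl⟩
    refine ⟨_, ⟨_, homogeneousComponent_isHomogeneous (m - s) a, rfl⟩,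
      _, ⟨_, homogeneousComponent_isHomogeneous (m - t) b, rfl⟩, ?_⟩
    rw [LinearMap.mulLeft_apply, LinearMap.mulLeft_apply, ← homogeneousComponent_mul hf hs,
      ← homogeneousComponent_mul hg ht, ← map_add, mul_comm f, mul_comm g]
    exact homogeneousComponent_eq_self hp
  · rintro ⟨_, ⟨a, ha, rfl⟩, _, ⟨b, hb, rfl⟩, rfl⟩
    refine ⟨?_, a, b, by simp [mul_comm]⟩
    refine IsHomogeneous.add ?_ ?_
    · have := hf.mul ha
      rwa [Nat.add_sub_cancel' hs] at this
    · have := hg.mul hb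
      rwa [Nat.add_sub_cancel' ht] at this

/-- The Koszul relation is the only relation between `f` and `g`. -/
lemma formMultiples_inf {f g : MvPolynomial σ k} {s t m : ℕ} (hf : f.IsHomogeneous s)
    (hg : g.IsHomogeneous t) (hfg : Prime f) (hdvd : ¬ f ∣ g) (h : s + t ≤ m) :
    formMultiples f s m ⊓ formMultiples g t m = formMultiples (f * g) (s + t) m := by
  ext p
  rw [Submodule.mem_inf, mem_formMultiples, mem_formMultiples, mem_formMultiples]
  constructor
  · rintro ⟨⟨a, -, rfl⟩, ⟨b, hb, hab⟩⟩
    obtain ⟨c, rfl⟩ := (hfg.dvd_or_dvd ⟨a, hab⟩).resolve_left hdvd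
    refine ⟨homogeneousComponent (m - (s + t)) c, homogeneousComponent_isHomogeneous _ _, ?_⟩
    have h1 := homogeneousComponent_mul hf (m := m - t) (by omega) c
    rw [homogeneousComponent_eq_self hb, show m - t - s = m - (s + t) by omega] at h1
    rw [← hab, h1]
    ring
  · rintro ⟨c, hc, rfl⟩
    refine ⟨⟨g * c, ?_, by ring⟩, ⟨f * c, ?_, by ring⟩⟩
    · have := hg.mul hc
      rwa [show t + (m - (s + t)) = m - s by omega] at this
    · have := hf.mul hc
      rwa [show s + (m - (s + t)) = m - t by omega] at this

lemma hilbertFunction_span_singleton [Fintype σ] {f : MvPolynomial σ k} {s m : ℕ}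
    (hf : f.IsHomogeneous s) (hf0 : f ≠ 0) (hs : s ≤ m) :
    hilbertFunction (Ideal.span {f}) m +
      (Fintype.card σ + (m - s) - 1).choose (m - s) = (Fintype.card σ + m - 1).choose m := by
  have h := hilbertFunction_add_finrank (Ideal.span {f}) m
  have hpair : Ideal.span {f} = Ideal.span {f, f} := by simp
  rw [hpair, homogeneousSubmodule_inf_span_pair hf hf hs hs, sup_idem, ← hpair,
    finrank_formMultiples hf0, finrank_homogeneousSubmodule, finrank_homogeneousSubmodule] at h
  exact h

lemma hilbertFunction_span_pair [Fintype σ] {f g : MvPolynomial σ k} {s t m : ℕ}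
    (hf : f.IsHomogeneous s) (hg : g.IsHomogeneous t) (hfp : Prime f) (hdvd : ¬ f ∣ g)
    (h : s + t ≤ m) :
    hilbertFunction (Ideal.span {f, g}) m + (Fintype.card σ + (m - s) - 1).choose (m - s) +
        (Fintype.card σ + (m - t) - 1).choose (m - t) =
      (Fintype.card σ + m - 1).choose m +
        (Fintype.card σ + (m - (s + t)) - 1).choose (m - (s + t)) := by
  have hg0 : g ≠ 0 := by
    rintro rfl
    exact hdvd (dvd_zero f)
  have h1 := hilbertFunction_add_finrank (Ideal.span {f, g}) m
  rw [homogeneousSubmodule_inf_span_pair hf hg (by omega) (by omega)] at h1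
  have : FiniteDimensional k (formMultiples f s m) :=
    Module.Finite.map (homogeneousSubmodule σ k (m - s)) (LinearMap.mulLeft k f)
  have : FiniteDimensional k (formMultiples g t m) :=
    Module.Finite.map (homogeneousSubmodule σ k (m - t)) (LinearMap.mulLeft k g)
  have h2 := Submodule.finrank_sup_add_finrank_inf_eq (formMultiples f s m) (formMultiples g t m)
  rw [formMultiples_inf hf hg hfp hdvd h, finrank_formMultiples (mul_ne_zero hfp.ne_zero hg0),
    finrank_formMultiples hfp.ne_zero, finrank_formMultiples hg0] at h2
  simp only [finrank_homogeneousSubmodule] at h1 h2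
  omega

end Hilbert

/-! ### Irreducibility -/

section Irreducible

variable {k : Type*} [Field k] {n : ℕ}

lemma finSuccEquiv_rename_succ {R : Type*} [CommSemiring R] (h : MvPolynomial (Fin n) R) :
    finSuccEquiv R n (rename Fin.succ h) = Polynomial.C h := by
  induction h using MvPolynomial.induction_on with
  | C a => simp [finSuccEquiv_apply]
  | add p q hp hq => rw [map_add, map_add, hp, hq, map_add]
  | mul_X p i hp => rw [map_mul, map_mul, hp, rename_X, finSuccEquiv_X_succ, map_mul]

/-- Eisenstein's criterion for `A X₀ ^ s + h(X₁, …, Xₙ)`, at the prime ideal of a point at which the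
hypersurface `h = 0` is smooth. The point may have coordinates in an extension field. -/
lemma irreducible_of_smooth_zero {K : Type*} [Field K] [Algebra k K] {A : k} (hA : A ≠ 0) {s : ℕ}
    (hs : s ≠ 0) (h : MvPolynomial (Fin n) k) (y : Fin n → K) (hy : aeval y h = 0) (j : Fin n)
    (hj : aeval y (pderiv j h) ≠ 0) :
    Irreducible (C A * X 0 ^ s + rename Fin.succ h) := by
  rw [← MulEquiv.irreducible_iff (finSuccEquiv k n)]
  have hF : finSuccEquiv k n (C A * X 0 ^ s + rename Fin.succ h) =
      Polynomial.C (C A) * Polynomial.X ^ s + Polynomial.C h := by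
    rw [map_add, map_mul, map_pow, finSuccEquiv_X_zero, finSuccEquiv_rename_succ, finSuccEquiv_apply]
    simp
  have hCA : IsUnit (C A : MvPolynomial (Fin n) k) := (isUnit_iff_ne_zero.2 hA).map C
  have hdeg : (Polynomial.C (C A) * Polynomial.X ^ s + Polynomial.C h :
      Polynomial (MvPolynomial (Fin n) k)).natDegree = s := by
    have hlt : (Polynomial.C h).natDegree < (Polynomial.C (C A : MvPolynomial (Fin n) k) *
        Polynomial.X ^ s).natDegree := by
      rw [Polynomial.natDegree_C, Polynomial.natDegree_C_mul_X_pow _ _ hCA.ne_zero]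
      omega
    rw [Polynomial.natDegree_add_eq_left_of_natDegree_lt hlt,
      Polynomial.natDegree_C_mul_X_pow _ _ hCA.ne_zero]
  have hlead : (Polynomial.C (C A) * Polynomial.X ^ s + Polynomial.C h :
      Polynomial (MvPolynomial (Fin n) k)).coeff s = C A := by
    simp [Polynomial.coeff_C, hs]
  rw [hF]
  refine Polynomial.irreducible_of_eisenstein_criterion
    (RingHom.ker_isPrime (aeval y : MvPolynomial (Fin n) k →ₐ[k] K).toRingHom) ?_ ?_ ?_ ?_ ?_
  · rw [Polynomial.leadingCoeff, hdeg, hlead]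
    simp [RingHom.mem_ker, hA]
  · intro i hi
    have hi' : i < s := by
      rw [← hdeg]
      exact Polynomial.coe_lt_degree.1 hi
    rcases Nat.eq_zero_or_pos i with rfl | hpos
    · simpa [hs.symm, RingHom.mem_ker, Polynomial.coeff_X_pow] using hy
    · simp [Polynomial.coeff_C, hpos.ne', hi'.ne, Polynomial.coeff_X_pow]
  · rw [← Polynomial.natDegree_pos_iff_degree_pos, hdeg]
    omega
  · intro hmem
    refine hj ?_
    have h0 : (Polynomial.C (C A) * Polynomial.X ^ s + Polynomial.C h :
      Polynomial (MvPolynomial (Fin n) k)).coeff 0 = h := by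
      simp [hs.symm, Polynomial.coeff_X_pow]
    rw [h0, pow_two] at hmem
    refine Submodule.mul_induction_on hmem (fun a ha b hb => ?_) fun a b ha hb => ?_
    · have ha' : aeval y a = 0 := ha
      have hb' : aeval y b = 0 := hb
      simp [Derivation.leibniz, ha', hb']
    · rw [map_add, map_add, ha, hb, add_zero]
  · intro r hr
    have := Polynomial.C_dvd_iff_dvd_coeff _ _ |>.1 hr s
    rw [hlead] at this
    exact isUnit_of_dvd_unit this hCA

/-- The binary form `B X₁ ^ s + D X₂ ^ s` is smooth at its zero `(ζ, 1)` with `ζ ^ s = -D / B`. -/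
lemma prime_diagonal [CharZero k] {A B D : k} (hA : A ≠ 0) (hB : B ≠ 0) (hD : D ≠ 0) {s : ℕ}
    (hs : s ≠ 0) :
    Prime (C A * X 0 ^ s + C B * X 1 ^ s + C D * X 2 ^ s : MvPolynomial (Fin (n + 3)) k) := by
  obtain ⟨ζ, hζ⟩ := IsAlgClosed.exists_pow_nat_eq
    (-(algebraMap k (AlgebraicClosure k) D) / algebraMap k (AlgebraicClosure k) B)
    (Nat.pos_of_ne_zero hs)
  have hB' : algebraMap k (AlgebraicClosure k) B ≠ 0 := by simpa using hB
  have hD' : algebraMap k (AlgebraicClosure k) D ≠ 0 := by simpa using hD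
  have hs' : (s : AlgebraicClosure k) ≠ 0 := by
    have : CharZero (AlgebraicClosure k) := algebraRat.charZero _
    exact_mod_cast hs
  have hζ0 : ζ ≠ 0 := by
    rintro rfl
    rw [zero_pow hs] at hζ
    exact div_ne_zero (neg_ne_zero.2 hD') hB' hζ.symm
  have h := irreducible_of_smooth_zero hA hs
    (C B * X 0 ^ s + C D * X 1 ^ s : MvPolynomial (Fin (n + 2)) k)
    (Fin.cons ζ (Fin.cons 1 0) : Fin (n + 2) → AlgebraicClosure k) ?_ 0 ?_
  · have h1 : (C A * X 0 ^ s + C B * X 1 ^ s + C D * X 2 ^ s : MvPolynomial (Fin (n + 3)) k) =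
        C A * X 0 ^ s + rename Fin.succ (C B * X 0 ^ s + C D * X 1 ^ s) := by
      simp [add_assoc]
    rw [h1]
    exact h.prime
  · have h1 : (Fin.cons ζ (Fin.cons 1 0) : Fin (n + 2) → AlgebraicClosure k) 1 = 1 := rfl
    simp only [map_add, map_mul, map_pow, aeval_C, aeval_X, Fin.cons_zero, h1, hζ]
    field_simp
    simp
  · have h1 : (Fin.cons ζ (Fin.cons 1 0) : Fin (n + 2) → AlgebraicClosure k) 1 = 1 := rfl
    simp [Derivation.leibniz, Derivation.leibniz_pow, pderiv_X, hB, hs', hζ0]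

/-- The double cover of the projective line with coordinates `X 1` and `X 2` that is branched at the
four zeros of a binary quartic form, the difference of two squares. At a zero of the factor
`√p (X 1² + X 2²) - √q (X 1² - X 2²)`, the quartic form is smooth. -/
lemma prime_doubleCover {K : Type*} [Field K] [IsAlgClosed K] [CharZero K] {p q : K} (hp : p ≠ 0)
    (hq : q ≠ 0) (hpq : p ≠ q) :
    Prime (X 0 ^ 2 + (C p * (X 1 ^ 2 + X 2 ^ 2) ^ 2 - C q * (X 1 ^ 2 - X 2 ^ 2) ^ 2) :
      MvPolynomial (Fin 3) K) := by
  obtain ⟨μ, rfl⟩ := IsAlgClosed.exists_pow_nat_eq p two_pos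
  obtain ⟨ν, rfl⟩ := IsAlgClosed.exists_pow_nat_eq q two_pos
  have hμ : μ ≠ 0 := fun h => hp (by simp [h])
  have hν : ν ≠ 0 := fun h => hq (by simp [h])
  have h1 : μ - ν ≠ 0 := fun h => hpq (by rw [sub_eq_zero.1 h])
  have h2 : μ + ν ≠ 0 := fun h => hpq (by rw [eq_neg_of_add_eq_zero_left h]; ring)
  obtain ⟨z, hz⟩ := IsAlgClosed.exists_pow_nat_eq (-(μ + ν) / (μ - ν)) two_pos
  have hz0 : z ≠ 0 := by
    rintro rfl
    rw [zero_pow two_ne_zero] at hz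
    exact div_ne_zero (neg_ne_zero.2 h2) h1 hz.symm
  have h := irreducible_of_smooth_zero (one_ne_zero (α := K)) two_ne_zero
    (C (μ ^ 2) * (X 0 ^ 2 + X 1 ^ 2) ^ 2 - C (ν ^ 2) * (X 0 ^ 2 - X 1 ^ 2) ^ 2 :
      MvPolynomial (Fin 2) K) (![z, 1] : Fin 2 → K) ?_ 0 ?_
  · have h1 : (X 0 ^ 2 + (C (μ ^ 2) * (X 1 ^ 2 + X 2 ^ 2) ^ 2
        - C (ν ^ 2) * (X 1 ^ 2 - X 2 ^ 2) ^ 2) : MvPolynomial (Fin 3) K) =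
        C 1 * X 0 ^ 2 + rename Fin.succ (C (μ ^ 2) * (X 0 ^ 2 + X 1 ^ 2) ^ 2
          - C (ν ^ 2) * (X 0 ^ 2 - X 1 ^ 2) ^ 2) := by
      simp
    rw [h1]
    exact h.prime
  · simp [hz]
    field_simp
    ring
  · have h3 : (4 : K) * z * (-2 * μ * ν) ≠ 0 := by simp [hz0, hμ, hν]
    refine ne_of_eq_of_ne ?_ h3
    simp [Derivation.leibniz, Derivation.leibniz_pow, pderiv_X, hz]
    field_simp
    ring

/-- Two diagonal quadrics in three-space: the first is a cone over a conic, which is parametrized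
by binary quadratic forms, and so the intersection is the image of an irreducible double cover of
the line. -/
lemma isPrime_radical_span_pair {K : Type*} [Field K] [IsAlgClosed K] [CharZero K]
    {A B D A' B' D' : K} (hA : A ≠ 0) (hB : B ≠ 0) (hD : D ≠ 0) (hA' : A' ≠ 0) (hB' : B' ≠ 0)
    (hD' : D' ≠ 0) (hAB : A' * B ≠ A * B') :
    (Ideal.span {C A * X 0 ^ 2 + C B * X 1 ^ 2 + C D * X 2 ^ 2,
      C A' * X 0 ^ 2 + C B' * X 1 ^ 2 + C D' * X 3 ^ 2} :
        Ideal (MvPolynomial (Fin 4) K)).radical.IsPrime := by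
  obtain ⟨a, rfl⟩ := IsAlgClosed.exists_pow_nat_eq A two_pos
  obtain ⟨b, hb⟩ := IsAlgClosed.exists_pow_nat_eq (-B) two_pos
  obtain ⟨d, hd⟩ := IsAlgClosed.exists_pow_nat_eq (-D) two_pos
  obtain rfl : B = -b ^ 2 := by rw [hb, neg_neg]
  obtain rfl : D = -d ^ 2 := by rw [hd, neg_neg]
  have ha0 : a ≠ 0 := fun h => hA (by simp [h])
  have hb0 : b ≠ 0 := fun h => hB (by simp [h])
  have hd0 : d ≠ 0 := fun h => hD (by simp [h])
  have hprime := prime_doubleCover (p := A' / (4 * a ^ 2 * D')) (q := -B' / (4 * b ^ 2 * D'))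
    (by simp [hA', hA, hD']) (by simp [hB', hb0, hD']) (by
      intro h
      field_simp at h
      exact hAB (by linear_combination -h))
  set Q : MvPolynomial (Fin 3) K := X 0 ^ 2 +
    (C (A' / (4 * a ^ 2 * D')) * (X 1 ^ 2 + X 2 ^ 2) ^ 2
      - C (-B' / (4 * b ^ 2 * D')) * (X 1 ^ 2 - X 2 ^ 2) ^ 2) with hQ
  let Φ : MvPolynomial (Fin 4) K →ₐ[K] MvPolynomial (Fin 3) K :=
    aeval ![C (1 / (2 * a)) * (X 1 ^ 2 + X 2 ^ 2), C (1 / (2 * b)) * (X 1 ^ 2 - X 2 ^ 2),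
      C (1 / d) * (X 1 * X 2), X 0]
  have hP : (Ideal.span {Q}).IsPrime := (Ideal.span_singleton_prime hprime.ne_zero).2 hprime
  set I : Ideal (MvPolynomial (Fin 4) K) := Ideal.span _ with hI
  have hrad : I.radical = (Ideal.span {Q}).comap Φ := by
    apply le_antisymm
    · refine (hP.comap Φ).isRadical.radical_le_iff.2 ?_
      rw [hI, Ideal.span_le]
      rintro f (rfl | rfl)
      · have h0 : Φ (C (a ^ 2) * X 0 ^ 2 + C (-b ^ 2) * X 1 ^ 2 + C (-d ^ 2) * X 2 ^ 2) = 0 := by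
          refine MvPolynomial.funext fun x => ?_
          simp [Φ]
          field_simp
          ring
        simp only [SetLike.mem_coe, Ideal.mem_comap, h0, zero_mem]
      · refine Ideal.mem_comap.2 (Ideal.mem_span_singleton'.2 ⟨C D', ?_⟩)
        refine MvPolynomial.funext fun x => ?_
        simp [Φ, Q]
        field_simp
        ring
    · intro f hf
      rw [← vanishingIdeal_zeroLocus_eq_radical (K := K)]
      intro y hy
      have h1 : a ^ 2 * y 0 ^ 2 + -b ^ 2 * y 1 ^ 2 + -d ^ 2 * y 2 ^ 2 = 0 := by
        simpa using hy _ (Ideal.subset_span (Set.mem_insert _ _))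
      have h2 : A' * y 0 ^ 2 + B' * y 1 ^ 2 + D' * y 3 ^ 2 = 0 := by
        simpa using hy _ (Ideal.subset_span (Set.mem_insert_of_mem _ rfl))
      -- The parametrization is surjective: the signs of the square roots can be matched to `y 2`.
      obtain ⟨u, v, hu, hv, huv⟩ : ∃ u v : K, u ^ 2 = a * y 0 + b * y 1 ∧
          v ^ 2 = a * y 0 - b * y 1 ∧ u * v = d * y 2 := by
        obtain ⟨u, hu⟩ := IsAlgClosed.exists_pow_nat_eq (a * y 0 + b * y 1) two_pos
        obtain ⟨v, hv⟩ := IsAlgClosed.exists_pow_nat_eq (a * y 0 - b * y 1) two_pos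
        have : (u * v) ^ 2 = (d * y 2) ^ 2 := by
          rw [mul_pow, hu, hv]
          linear_combination h1
        rcases sq_eq_sq_iff_eq_or_eq_neg.1 this with h | h
        · exact ⟨u, v, hu, hv, h⟩
        · exact ⟨u, -v, hu, by rw [neg_sq, hv], by rw [mul_neg, h, neg_neg]⟩
      have hcomp : ∀ g, aeval y g = aeval (![y 3, u, v] : Fin 3 → K) (Φ g) := by
        intro g
        rw [← AlgHom.comp_apply]
        congr 1
        refine MvPolynomial.algHom_ext fun i => ?_
        fin_cases i
        · simp [Φ, hu, hv]; field_simp; ring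
        · simp [Φ, hu, hv]; field_simp; ring
        · simp [Φ, huv]; field_simp
        · simp [Φ]
      obtain ⟨g, hg⟩ := Ideal.mem_span_singleton'.1 (Ideal.mem_comap.1 hf)
      rw [hcomp, ← hg, map_mul]
      have : aeval (![y 3, u, v] : Fin 3 → K) Q = 0 := by
        simp [Q, hu, hv]
        field_simp
        linear_combination 4 * h2
      rw [this, mul_zero]
  rw [hrad]
  exact hP.comap Φ

end Irreducible

/-! ### Smooth diagonal curves -/

section DiagonalCurves

variable {k : Type*} [Field k]

lemma two_mul_choose_add_two (m : ℕ) : 2 * (m + 2).choose m = (m + 1) * (m + 2) := by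
  have h := Nat.ascFactorial_eq_factorial_mul_choose m 2
  rw [← Nat.choose_symm_add] at h
  simpa [Nat.ascFactorial, Nat.factorial, mul_comm, mul_assoc] using h.symm

lemma six_mul_choose_add_three (m : ℕ) :
    6 * (m + 3).choose m = (m + 1) * (m + 2) * (m + 3) := by
  have h := Nat.ascFactorial_eq_factorial_mul_choose m 3
  rw [← Nat.choose_symm_add] at h
  simp only [Nat.ascFactorial, Nat.factorial] at h
  linarith

lemma isHomogeneous_diagonal {σ : Type*} (A B D : k) (s : ℕ) (i₀ i₁ i₂ : σ) :
    (C A * X i₀ ^ s + C B * X i₁ ^ s + C D * X i₂ ^ s : MvPolynomial σ k).IsHomogeneous s :=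
  ((isHomogeneous_C_mul_X_pow A i₀ s).add (isHomogeneous_C_mul_X_pow B i₁ s)).add
    (isHomogeneous_C_mul_X_pow D i₂ s)

lemma isSmoothCurveOfGenus_diagonal [CharZero k] {A B D : k} (hA : A ≠ 0) (hB : B ≠ 0)
    (hD : D ≠ 0) {s g : ℕ} (hs : 2 ≤ s) (hg : 2 * (g : ℤ) = (s - 1) * (s - 2)) :
    IsSmoothCurveOfGenus (Ideal.span {C A * X 0 ^ s + C B * X 1 ^ s + C D * X 2 ^ s} :
      Ideal (MvPolynomial (Fin 3) k)) g where
  homogeneous f hf m := homogeneousComponent_mem_span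
    (by rintro _ rfl; exact ⟨s, isHomogeneous_diagonal A B D s 0 1 2⟩) hf m
  geometrically_irreducible := by
    have : CharZero (AlgebraicClosure k) := algebraRat.charZero _
    rw [Ideal.map_span, Set.image_singleton]
    have hp := prime_diagonal (n := 0) (k := AlgebraicClosure k)
      (A := algebraMap k _ A) (B := algebraMap k _ B) (D := algebraMap k _ D) (s := s)
      (by simpa using hA) (by simpa using hB) (by simpa using hD) (by omega)
    have := (Ideal.span_singleton_prime hp.ne_zero).2 hp
    simpa [this.radical] using this
  smooth P hP := by
    have : CharZero (AlgebraicClosure k) := algebraRat.charZero _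
    have hs0 : (s : AlgebraicClosure k) ≠ 0 := by exact_mod_cast (by omega : s ≠ 0)
    rw [span_gradient_image_span fun f hf => hP f (Ideal.subset_span hf), Set.image_singleton,
      finrank_span_singleton, Fintype.card_fin]
    intro h0
    refine P.rep_nonzero ?_
    have hs1 : s - 1 ≠ 0 := by omega
    ext j
    have := congrFun h0 j
    fin_cases j <;>
    simpa [gradient, Derivation.leibniz, Derivation.leibniz_pow, pderiv_X, hA, hB, hD, hs0,
      hs1] using this
  hilbert_polynomial := by
    refine ⟨s, by omega, s, fun m hm => ?_⟩
    have h := hilbertFunction_span_singleton (isHomogeneous_diagonal A B D s (0 : Fin 3) 1 2)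
      (prime_diagonal (n := 0) hA hB hD (by omega)).ne_zero hm
    rw [Fintype.card_fin, show 3 + (m - s) - 1 = (m - s) + 2 by omega,
      show 3 + m - 1 = m + 2 by omega] at h
    have h1 := two_mul_choose_add_two m
    have h2 := two_mul_choose_add_two (m - s)
    obtain ⟨t, rfl⟩ := Nat.exists_eq_add_of_le hm
    rw [Nat.add_sub_cancel_left] at h h2
    zify at h h1 h2
    push_cast at h1 ⊢
    linarith

lemma isSmoothCurveOfGenus_one_diagonal_pair [CharZero k] {A B D A' B' D' : k} (hA : A ≠ 0)
    (hB : B ≠ 0) (hD : D ≠ 0) (hA' : A' ≠ 0) (hB' : B' ≠ 0) (hD' : D' ≠ 0)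
    (hAB : A' * B ≠ A * B') :
    IsSmoothCurveOfGenus (Ideal.span {C A * X 0 ^ 2 + C B * X 1 ^ 2 + C D * X 2 ^ 2,
      C A' * X 0 ^ 2 + C B' * X 1 ^ 2 + C D' * X 3 ^ 2} : Ideal (MvPolynomial (Fin 4) k)) 1 where
  homogeneous f hf m := by
    refine homogeneousComponent_mem_span ?_ hf m
    rintro _ (rfl | rfl)
    · exact ⟨2, isHomogeneous_diagonal A B D 2 0 1 2⟩
    · exact ⟨2, isHomogeneous_diagonal A' B' D' 2 0 1 3⟩
  geometrically_irreducible := by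
    have : CharZero (AlgebraicClosure k) := algebraRat.charZero _
    have hinj := (algebraMap k (AlgebraicClosure k)).injective
    have hp := isPrime_radical_span_pair (K := AlgebraicClosure k)
      (A := algebraMap k _ A) (B := algebraMap k _ B) (D := algebraMap k _ D)
      (A' := algebraMap k _ A') (B' := algebraMap k _ B') (D' := algebraMap k _ D')
      (by simpa using hA) (by simpa using hB) (by simpa using hD)
      (by simpa using hA') (by simpa using hB') (by simpa using hD')
      (by rw [← map_mul, ← map_mul]; exact hinj.ne hAB)
    rw [Ideal.map_span, Set.image_pair]
    simpa using hp
  smooth P hP := by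
    have : CharZero (AlgebraicClosure k) := algebraRat.charZero _
    have hinj := (algebraMap k (AlgebraicClosure k)).injective
    have hAB' : algebraMap k (AlgebraicClosure k) A' * algebraMap k _ B ≠
        algebraMap k _ A * algebraMap k _ B' := by
      rw [← map_mul, ← map_mul]
      exact hinj.ne hAB
    rw [span_gradient_image_span fun f hf => hP f (Ideal.subset_span hf), Set.image_pair,
      Fintype.card_fin]
    have h1 := hP _ (Ideal.subset_span (Set.mem_insert _ _))
    have h2 := hP _ (Ideal.subset_span (Set.mem_insert_of_mem _ rfl))
    have hli : LinearIndependent (AlgebraicClosure k)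
        ![gradient P.rep (C A * X 0 ^ 2 + C B * X 1 ^ 2 + C D * X 2 ^ 2),
          gradient P.rep (C A' * X 0 ^ 2 + C B' * X 1 ^ 2 + C D' * X 3 ^ 2)] := by
      rw [LinearIndependent.pair_iff]
      intro u v huv
      have e : ∀ j, _ := fun j => congrFun huv j
      have e0 := e 0
      have e1 := e 1
      have e2 := e 2
      have e3 := e 3
      have hne := P.rep_nonzero
      simp [gradient, Derivation.leibniz, Derivation.leibniz_pow, pderiv_X, hD, hD'] at e0 e1 e2 e3
      simp at h1 h2
      by_cases h2' : P.rep 2 = 0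
      · by_cases h3' : P.rep 3 = 0
        · exfalso
          simp only [h2', h3'] at h1 h2
          have h0 : P.rep 0 ^ 2 = 0 := by
            refine (mul_eq_zero.1 (?_ : (algebraMap k (AlgebraicClosure k) A' * algebraMap k _ B -
              algebraMap k _ A * algebraMap k _ B') * P.rep 0 ^ 2 = 0)).resolve_left
                (sub_ne_zero.2 hAB')
            linear_combination algebraMap k _ B * h2 - algebraMap k _ B' * h1
          have h0' : P.rep 0 = 0 := by simpa using h0
          have h1' : P.rep 1 = 0 := by simpa [h0', hB] using h1
          refine hne (funext fun j => ?_)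
          fin_cases j <;> simpa
        · have hv : v = 0 := by simpa [h3'] using e3
          refine ⟨?_, hv⟩
          by_contra hu
          have h0' : P.rep 0 = 0 := by simpa [hv, hu, hA] using e0
          have h1' : P.rep 1 = 0 := by simpa [hv, hu, hB] using e1
          simp [h0', h1', h3', hD'] at h2
      · have hu : u = 0 := by simpa [h2'] using e2
        refine ⟨hu, ?_⟩
        by_contra hv
        have h0' : P.rep 0 = 0 := by simpa [hv, hu, hA'] using e0
        have h1' : P.rep 1 = 0 := by simpa [hv, hu, hB'] using e1
        simp [h0', h1', h2', hD] at h1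
    have h := finrank_span_eq_card hli
    rw [Matrix.range_cons_cons_empty, Fintype.card_fin] at h
    rw [h]
  hilbert_polynomial := by
    refine ⟨4, by omega, 4, fun m hm => ?_⟩
    have h := hilbertFunction_span_pair (isHomogeneous_diagonal A B D 2 (0 : Fin 4) 1 2)
      (isHomogeneous_diagonal A' B' D' 2 (0 : Fin 4) 1 3)
      (prime_diagonal (n := 1) hA hB hD (by omega)) ?_ (m := m) hm
    · obtain ⟨t, rfl⟩ := Nat.exists_eq_add_of_le hm
      rw [Fintype.card_fin, show 4 + t - 2 = t + 2 by omega, show 4 + t - (2 + 2) = t by omega,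
        show 4 + (t + 2) - 1 = t + 2 + 3 by omega, show 4 + (4 + t) - 1 = 4 + t + 3 by omega,
        show 4 + t - 1 = t + 3 by omega] at h
      have h1 := six_mul_choose_add_three (4 + t)
      have h2 := six_mul_choose_add_three (t + 2)
      have h3 := six_mul_choose_add_three t
      zify at h h1 h2 h3
      push_cast at h1 ⊢
      linarith
    · -- The first form vanishes at `(0, 0, 0, 1)`, the second does not.
      rintro ⟨q, hq⟩
      have := congrArg (aeval (![0, 0, 0, 1] : Fin 4 → k)) hq
      simp [hD'] at this

/-- The point with parameter `m` of a conic through the points `[±1 : ±1 : 1]`. The parameter is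
infinite at `[1 : 1 : 1]`, and it is `-a`, `-b`, `-c` at the three other points. -/
def conicPoint (a b c m : k) : Fin 3 → k :=
  ![m ^ 2 + 2 * a * m + (a * b + a * c - b * c), m ^ 2 + 2 * b * m + (a * b + b * c - a * c),
    m ^ 2 + 2 * c * m + (a * c + b * c - a * b)]

lemma conicPoint_mem (a b c m : k) :
    (c - b) * conicPoint a b c m 0 ^ 2 + (a - c) * conicPoint a b c m 1 ^ 2 +
      (b - a) * conicPoint a b c m 2 ^ 2 = 0 := by
  simp [conicPoint]
  ring

lemma eq_of_conicPoint_eq_smul [CharZero k] {a b c : k} (hab : a ≠ b) (hbc : b ≠ c) (hac : a ≠ c)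
    {m m' u : k} (h : u • conicPoint a b c m' = conicPoint a b c m) : u = 1 ∧ m = m' := by
  have h0 := congrFun h 0
  have h1 := congrFun h 1
  have h2 := congrFun h 2
  simp [conicPoint] at h0 h1 h2
  have e1 : m + c = u * (m' + c) := by
    refine mul_left_cancel₀ (mul_ne_zero two_ne_zero (sub_ne_zero.2 hab)) ?_
    linear_combination h1 - h0
  have e2 : m + a = u * (m' + a) := by
    refine mul_left_cancel₀ (mul_ne_zero two_ne_zero (sub_ne_zero.2 hbc)) ?_
    linear_combination h2 - h1
  have hu : u = 1 := by
    refine mul_left_cancel₀ (sub_ne_zero.2 hac) ?_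
    linear_combination e1 - e2
  subst hu
  exact ⟨rfl, by linear_combination e1⟩

lemma conicPoint_ne_zero [CharZero k] {a b c : k} (hab : a ≠ b) (hbc : b ≠ c) (hac : a ≠ c)
    (m : k) : conicPoint a b c m ≠ 0 := fun h =>
  zero_ne_one (eq_of_conicPoint_eq_smul hab hbc hac (u := 0) (m := m) (m' := m) (by simp [h])).1

end DiagonalCurves

section Fibers

variable {k : Type*} [Field k]

lemma fiberIdeal_plane (r s : ℕ) (α : Fin (2 + 1) → k) :
    fiberIdeal r s α = Ideal.span {C (α 2 ^ r - α 1 ^ r) * X 0 ^ s +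
      C (α 0 ^ r - α 2 ^ r) * X 1 ^ s + C (α 1 ^ r - α 0 ^ r) * X 2 ^ s} := by
  rw [fiberIdeal]
  congr 1
  ext f
  constructor
  · rintro ⟨i, hi, rfl⟩
    obtain rfl : i = 2 := by fin_cases i <;> simp_all
    rfl
  · rintro rfl
    exact ⟨2, le_rfl, rfl⟩

lemma fiberIdeal_space (r s : ℕ) (α : Fin (3 + 1) → k) :
    fiberIdeal r s α = Ideal.span {C (α 2 ^ r - α 1 ^ r) * X 0 ^ s +
        C (α 0 ^ r - α 2 ^ r) * X 1 ^ s + C (α 1 ^ r - α 0 ^ r) * X 2 ^ s,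
      C (α 3 ^ r - α 1 ^ r) * X 0 ^ s +
        C (α 0 ^ r - α 3 ^ r) * X 1 ^ s + C (α 1 ^ r - α 0 ^ r) * X 3 ^ s} := by
  rw [fiberIdeal]
  congr 1
  ext f
  constructor
  · rintro ⟨i, hi, rfl⟩
    obtain rfl | rfl : i = 2 ∨ i = 3 := by fin_cases i <;> simp_all
    · exact Or.inl rfl
    · exact Or.inr rfl
  · rintro (rfl | rfl)
    · exact ⟨2, le_rfl, rfl⟩
    · exact ⟨3, (by decide : 2 ≤ 3), rfl⟩

lemma IsAdmissible.sub_ne_zero {r n : ℕ} {α : Fin (n + 1) → k} (h : IsAdmissible r α)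
    {i j : Fin (n + 1)} (hij : i ≠ j) : α i ^ r - α j ^ r ≠ 0 :=
  _root_.sub_ne_zero.2 (h i j hij)

lemma isSmoothCurveOfGenus_fiberIdeal_plane [CharZero k] {r : ℕ} {α : Fin (2 + 1) → k}
    (h : IsAdmissible r α) {s g : ℕ} (hs : 2 ≤ s) (hg : 2 * (g : ℤ) = (s - 1) * (s - 2)) :
    IsSmoothCurveOfGenus (fiberIdeal r s α) g := by
  rw [fiberIdeal_plane]
  exact isSmoothCurveOfGenus_diagonal (h.sub_ne_zero (by decide)) (h.sub_ne_zero (by decide))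
    (h.sub_ne_zero (by decide)) hs hg

lemma isSmoothCurveOfGenus_fiberIdeal_space [CharZero k] {r : ℕ} {α : Fin (3 + 1) → k}
    (h : IsAdmissible r α) : IsSmoothCurveOfGenus (fiberIdeal r 2 α) 1 := by
  rw [fiberIdeal_space]
  refine isSmoothCurveOfGenus_one_diagonal_pair (h.sub_ne_zero (by decide))
    (h.sub_ne_zero (by decide)) (h.sub_ne_zero (by decide)) (h.sub_ne_zero (by decide))
    (h.sub_ne_zero (by decide)) (h.sub_ne_zero (by decide)) ?_
  have h1 := mul_ne_zero (h.sub_ne_zero (show (0 : Fin 4) ≠ 1 by decide))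
    (h.sub_ne_zero (show (3 : Fin 4) ≠ 2 by decide))
  intro h2
  exact h1 (by linear_combination h2)

lemma isConic_fiberIdeal [CharZero k] {r : ℕ} {α : Fin (2 + 1) → k} (h : IsAdmissible r α) :
    IsConic (fiberIdeal r 2 α) :=
  ⟨_, (prime_diagonal (n := 0) (h.sub_ne_zero (by decide)) (h.sub_ne_zero (by decide))
    (h.sub_ne_zero (by decide)) two_ne_zero).ne_zero, isHomogeneous_diagonal _ _ _ 2 0 1 2,
    fiberIdeal_plane r 2 α⟩

lemma mk_mem_points_fiberIdeal_plane {r s : ℕ} {α : Fin (2 + 1) → k} {v : Fin (2 + 1) → k}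
    (hv : v ≠ 0) : Projectivization.mk k v hv ∈ points (fiberIdeal r s α) k ↔
      (α 2 ^ r - α 1 ^ r) * v 0 ^ s + (α 0 ^ r - α 2 ^ r) * v 1 ^ s +
        (α 1 ^ r - α 0 ^ r) * v 2 ^ s = 0 := by
  rw [fiberIdeal_plane, mk_mem_points_iff]
  · simp
  · rintro _ rfl
    exact ⟨s, isHomogeneous_diagonal _ _ _ s 0 1 2⟩

lemma infinite_points_conic [CharZero k] {r : ℕ} {α : Fin (2 + 1) → k} (h : IsAdmissible r α) :
    (points (fiberIdeal r 2 α) k).Infinite := by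
  have h01 := h 0 1 (by decide)
  have h12 := h 1 2 (by decide)
  have h02 := h 0 2 (by decide)
  refine Set.infinite_of_injective_forall_mem (f := fun m : k => Projectivization.mk k
    (conicPoint (α 0 ^ r) (α 1 ^ r) (α 2 ^ r) m) (conicPoint_ne_zero h01 h12 h02 m)) ?_ ?_
  · intro m m' hm
    obtain ⟨u, hu⟩ := (Projectivization.mk_eq_mk_iff' _ _ _ _ _).1 hm
    exact (eq_of_conicPoint_eq_smul h01 h12 h02 hu).2
  · intro m
    rw [mk_mem_points_fiberIdeal_plane]
    exact conicPoint_mem _ _ _ m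

end Fibers

/-! ### Isomorphisms given by forms -/

section Correspondence

variable {k : Type*} [Field k] {σ τ ι κ : Type*}

/-- The value at `v` of a tuple of polynomials. -/
def evalTuple {L : Type*} [Field L] [Algebra k L] (F : τ → MvPolynomial σ k) (v : σ → L) : τ → L :=
  fun j => aeval v (F j)

lemma evalTuple_smul {L : Type*} [Field L] [Algebra k L] {F : τ → MvPolynomial σ k} {d : ℕ}
    (hF : ∀ j, (F j).IsHomogeneous d) (c : L) (v : σ → L) :
    evalTuple F (c • v) = c ^ d • evalTuple F v :=
  funext fun j => aeval_smul_of_isHomogeneous (hF j) c v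

/-- A relation that is total on the left and is expressed by tuples of forms that do not vanish
simultaneously is the graph of a morphism. -/
lemma exists_isMorphism {I : Ideal (MvPolynomial σ k)} {J : Ideal (MvPolynomial τ k)}
    {F : ι → τ → MvPolynomial σ k} {d : ι → ℕ} (hF : ∀ i j, (F i j).IsHomogeneous (d i))
    {R : (σ → AlgebraicClosure k) → (τ → AlgebraicClosure k) → Prop}
    (htot : ∀ P ∈ points I (AlgebraicClosure k), ∃ Q ∈ points J (AlgebraicClosure k),
      R P.rep Q.rep)
    (hR : ∀ v w, R v w → ∀ i, ∃ c : AlgebraicClosure k, evalTuple (F i) v = c • w)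
    (hR' : ∀ v w, R v w → ∃ i, evalTuple (F i) v ≠ 0) :
    ∃ φ : points I (AlgebraicClosure k) → points J (AlgebraicClosure k),
      IsMorphism φ ∧ ∀ P, R P.1.rep (φ P).1.rep := by
  choose φ hφ hφR using htot
  refine ⟨fun P => ⟨φ P.1 P.2, hφ P.1 P.2⟩, fun P => ?_, fun P => hφR P.1 P.2⟩
  obtain ⟨i, hi⟩ := hR' _ _ (hφR P.1 P.2)
  refine ⟨d i, F i, hF i, hi, fun Q hQ => ?_⟩
  obtain ⟨c, hc⟩ := hR _ _ (hφR Q.1 Q.2) i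
  exact (((Projectivization.mk_eq_mk_iff' _ _ _ hQ (φ Q.1 Q.2).rep_nonzero).2
    ⟨c, hc.symm⟩).trans (Projectivization.mk_rep _)).symm

/-- A criterion for an isomorphism. A relation between geometric vectors, which up to scaling is
total on both sides, and under which the tuples of forms `F i` take `v` into the line of `w` and the
tuples `G i` take `w` into the line of `v`, not all to zero, is the graph of an isomorphism. -/
theorem isIsomorphic_of_relation {S : Set (MvPolynomial σ k)} {T : Set (MvPolynomial τ k)}
    (hS : ∀ f ∈ S, ∃ n, f.IsHomogeneous n) (hT : ∀ f ∈ T, ∃ n, f.IsHomogeneous n)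
    {F : ι → τ → MvPolynomial σ k} {d : ι → ℕ} (hF : ∀ i j, (F i j).IsHomogeneous (d i))
    {G : κ → σ → MvPolynomial τ k} {e : κ → ℕ} (hG : ∀ i j, (G i j).IsHomogeneous (e i))
    (R : (σ → AlgebraicClosure k) → (τ → AlgebraicClosure k) → Prop)
    (hleft : ∀ v ≠ 0, (∀ f ∈ S, aeval v f = 0) →
      ∃ (c : AlgebraicClosure k) (v' : _) (w : _), v = c • v' ∧ R v' w)
    (hright : ∀ w ≠ 0, (∀ f ∈ T, aeval w f = 0) →
      ∃ (c : AlgebraicClosure k) (v : _) (w' : _), w = c • w' ∧ R v w')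
    (hRS : ∀ v w, R v w → ∀ f ∈ S, aeval v f = 0)
    (hRT : ∀ v w, R v w → ∀ f ∈ T, aeval w f = 0)
    (hRF : ∀ v w, R v w → ∀ i, ∃ c : AlgebraicClosure k, evalTuple (F i) v = c • w)
    (hRF' : ∀ v w, R v w → ∃ i, evalTuple (F i) v ≠ 0)
    (hRG : ∀ v w, R v w → ∀ i, ∃ c : AlgebraicClosure k, evalTuple (G i) w = c • v)
    (hRG' : ∀ v w, R v w → ∃ i, evalTuple (G i) w ≠ 0) :
    IsIsomorphic (Ideal.span S) (Ideal.span T) := by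
  have hRw : ∀ v w, R v w → w ≠ 0 := by
    rintro v w h rfl
    obtain ⟨i, hi⟩ := hRF' _ _ h
    obtain ⟨c, hc⟩ := hRF _ _ h i
    exact hi (by rw [hc, smul_zero])
  have hRv : ∀ v w, R v w → v ≠ 0 := by
    rintro v w h rfl
    obtain ⟨i, hi⟩ := hRG' _ _ h
    obtain ⟨c, hc⟩ := hRG _ _ h i
    exact hi (by rw [hc, smul_zero])
  -- The closure of `R` under scaling on both sides.
  let R' : (σ → AlgebraicClosure k) → (τ → AlgebraicClosure k) → Prop := fun v w =>
    ∃ (a b : AlgebraicClosure k) (v' : _) (w' : _), a ≠ 0 ∧ b ≠ 0 ∧ v = a • v' ∧ w = b • w' ∧ R v' w'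
  have hF1 : ∀ v w, R' v w → ∀ i, ∃ c : AlgebraicClosure k, evalTuple (F i) v = c • w := by
    rintro _ _ ⟨a, b, v, w, -, hb, rfl, rfl, h⟩ i
    obtain ⟨c, hc⟩ := hRF v w h i
    exact ⟨a ^ d i * c * b⁻¹, by
      rw [evalTuple_smul (hF i), hc, smul_smul, smul_smul, inv_mul_cancel_right₀ hb]⟩
  have hG1 : ∀ v w, R' v w → ∀ i, ∃ c : AlgebraicClosure k, evalTuple (G i) w = c • v := by
    rintro _ _ ⟨a, b, v, w, ha, -, rfl, rfl, h⟩ i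
    obtain ⟨c, hc⟩ := hRG v w h i
    exact ⟨b ^ e i * c * a⁻¹, by
      rw [evalTuple_smul (hG i), hc, smul_smul, smul_smul, inv_mul_cancel_right₀ ha]⟩
  have hF2 : ∀ v w, R' v w → ∃ i, evalTuple (F i) v ≠ 0 := by
    rintro _ _ ⟨a, b, v, w, ha, -, rfl, rfl, h⟩
    obtain ⟨i, hi⟩ := hRF' v w h
    exact ⟨i, by rw [evalTuple_smul (hF i)]; exact smul_ne_zero (pow_ne_zero _ ha) hi⟩
  have hG2 : ∀ v w, R' v w → ∃ i, evalTuple (G i) w ≠ 0 := by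
    rintro _ _ ⟨a, b, v, w, -, hb, rfl, rfl, h⟩
    obtain ⟨i, hi⟩ := hRG' v w h
    exact ⟨i, by rw [evalTuple_smul (hG i)]; exact smul_ne_zero (pow_ne_zero _ hb) hi⟩
  have htot : ∀ P ∈ points (Ideal.span S) (AlgebraicClosure k),
      ∃ Q ∈ points (Ideal.span T) (AlgebraicClosure k), R' P.rep Q.rep := by
    intro P hP
    obtain ⟨c, v, w, hv, h⟩ := hleft P.rep P.rep_nonzero
      fun f hf => hP f (Ideal.subset_span hf)
    have hc : c ≠ 0 := by
      rintro rfl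
      exact P.rep_nonzero (by rw [hv, zero_smul])
    obtain ⟨u, hu⟩ := Projectivization.exists_smul_eq_mk_rep (AlgebraicClosure k) w (hRw _ _ h)
    exact ⟨Projectivization.mk _ w (hRw _ _ h), (mk_mem_points_iff hT _ _).2 (hRT _ _ h),
      c, u, v, w, hc, u.ne_zero, hv, hu.symm, h⟩
  have htot' : ∀ Q ∈ points (Ideal.span T) (AlgebraicClosure k),
      ∃ P ∈ points (Ideal.span S) (AlgebraicClosure k), R' P.rep Q.rep := by
    intro Q hQ
    obtain ⟨c, v, w, hw, h⟩ := hright Q.rep Q.rep_nonzero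
      fun f hf => hQ f (Ideal.subset_span hf)
    have hc : c ≠ 0 := by
      rintro rfl
      exact Q.rep_nonzero (by rw [hw, zero_smul])
    obtain ⟨u, hu⟩ := Projectivization.exists_smul_eq_mk_rep (AlgebraicClosure k) v (hRv _ _ h)
    exact ⟨Projectivization.mk _ v (hRv _ _ h), (mk_mem_points_iff hS _ _).2 (hRS _ _ h),
      u, c, v, w, u.ne_zero, hc, hu.symm, hw, h⟩
  obtain ⟨φ, hφ, hφR⟩ := exists_isMorphism hF htot hF1 hF2
  obtain ⟨ψ, hψ, hψR⟩ := exists_isMorphism (R := fun w v => R' v w) hG htot'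
    (fun w v h => hG1 v w h) (fun w v h => hG2 v w h)
  have hl : ∀ P, ψ (φ P) = P := by
    intro P
    obtain ⟨i, hi⟩ := hG2 _ _ (hφR P)
    obtain ⟨c, hc⟩ := hG1 _ _ (hφR P) i
    obtain ⟨c', hc'⟩ := hG1 _ _ (hψR (φ P)) i
    have hc0 : c' ≠ 0 := by
      rintro rfl
      exact hi (by rw [hc', zero_smul])
    apply Subtype.ext
    rw [← Projectivization.mk_rep (ψ (φ P)).1, ← Projectivization.mk_rep P.1,
      Projectivization.mk_eq_mk_iff']
    exact ⟨c'⁻¹ * c, by rw [mul_smul, ← hc, hc', inv_smul_smul₀ hc0]⟩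
  have hr : ∀ Q, φ (ψ Q) = Q := by
    intro Q
    obtain ⟨i, hi⟩ := hF2 _ _ (hψR Q)
    obtain ⟨c, hc⟩ := hF1 _ _ (hψR Q) i
    obtain ⟨c', hc'⟩ := hF1 _ _ (hφR (ψ Q)) i
    have hc0 : c' ≠ 0 := by
      rintro rfl
      exact hi (by rw [hc', zero_smul])
    apply Subtype.ext
    rw [← Projectivization.mk_rep (φ (ψ Q)).1, ← Projectivization.mk_rep Q.1,
      Projectivization.mk_eq_mk_iff']
    exact ⟨c'⁻¹ * c, by rw [mul_smul, ← hc, hc', inv_smul_smul₀ hc0]⟩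
  exact ⟨⟨φ, ψ, hl, hr⟩, hφ, hψ⟩

end Correspondence

section Weierstrass

variable {k : Type*} [Field k]

lemma isHomogeneous_weierstrass (E : WeierstrassCurve k) :
    E.toProjective.polynomial.IsHomogeneous 3 := by
  have h : ∀ i : Fin 3, (X i : MvPolynomial (Fin 3) k).IsHomogeneous 1 := isHomogeneous_X k
  rw [WeierstrassCurve.Projective.polynomial]
  exact ((((h 1).pow 2).mul (h 2)).add ((((h 0).C_mul _).mul (h 1)).mul (h 2)) |>.add
    (((h 1).C_mul _).mul ((h 2).pow 2))).sub (((((h 0).pow 3).add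
      ((((h 0).pow 2).C_mul _).mul (h 2))).add (((h 0).C_mul _).mul ((h 2).pow 2))).add
        (((h 2).pow 3).C_mul _))

lemma aeval_weierstrass {L : Type*} [Field L] [Algebra k L] (a₂ a₄ a₆ : k) (w : Fin 3 → L) :
    aeval w (WeierstrassCurve.toProjective ⟨0, a₂, 0, a₄, a₆⟩).polynomial =
      w 1 ^ 2 * w 2 - (w 0 ^ 3 + algebraMap k L a₂ * w 0 ^ 2 * w 2 +
        algebraMap k L a₄ * w 0 * w 2 ^ 2 + algebraMap k L a₆ * w 2 ^ 3) := by
  simp [WeierstrassCurve.Projective.polynomial]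

end Weierstrass

/-! ### The intersection of two quadrics as a Weierstrass cubic -/

section QuadricFrame

variable {A : Type*} [CommRing A]

/-- The four diagonal coordinates, in terms of the coordinates `w = (1, m, m², x)` that a function
`m` of degree two and the Weierstrass function `x` provide. -/
def quadricFrame (a b c : A) (w : Fin 4 → A) : Fin 4 → A :=
  ![w 2 + 2 * a * w 1 + (a * b + a * c - b * c) * w 0,
    w 2 + 2 * b * w 1 + (a * b + b * c - a * c) * w 0,
    w 2 + 2 * c * w 1 + (a * c + b * c - a * b) * w 0,
    w 2 - 2 * w 3 - (a * b + b * c + a * c) * w 0]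

/-- The inverse of `quadricFrame`, up to the factor `4 (a - b) (b - c) (c - a)`. -/
def quadricCoframe (a b c : A) (y : Fin 4 → A) : Fin 4 → A :=
  let w₀ := (b - c) * y 0 + (c - a) * y 1 + (a - b) * y 2
  let w₁ := (b - c) * (c - a) * (y 0 - y 1) - c * w₀
  let Δ := 2 * (a - b) * (b - c) * (c - a)
  let w₂ := Δ * y 0 - 2 * a * w₁ - (a * b + a * c - b * c) * w₀
  ![2 * w₀, 2 * w₁, 2 * w₂, w₂ - (a * b + b * c + a * c) * w₀ - Δ * y 3]

lemma quadricCoframe_quadricFrame (a b c : A) (w : Fin 4 → A) :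
    quadricCoframe a b c (quadricFrame a b c w) = (4 * (a - b) * (b - c) * (c - a)) • w := by
  ext i
  fin_cases i <;> simp [quadricCoframe, quadricFrame] <;> ring

lemma quadricFrame_quadricCoframe (a b c : A) (y : Fin 4 → A) :
    quadricFrame a b c (quadricCoframe a b c y) = (4 * (a - b) * (b - c) * (c - a)) • y := by
  ext i
  fin_cases i <;> simp [quadricCoframe, quadricFrame] <;> ring

lemma quadricFrame_smul (a b c u : A) (w : Fin 4 → A) :
    quadricFrame a b c (u • w) = u • quadricFrame a b c w := by
  ext i
  fin_cases i <;> simp [quadricFrame] <;> ring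

lemma first_quadric_quadricFrame (a b c : A) (w : Fin 4 → A) :
    (c - b) * quadricFrame a b c w 0 ^ 2 + (a - c) * quadricFrame a b c w 1 ^ 2 +
      (b - a) * quadricFrame a b c w 2 ^ 2 =
    4 * (a - b) * (b - c) * (c - a) * (w 1 ^ 2 - w 0 * w 2) := by
  simp [quadricFrame]
  ring

lemma second_quadric_quadricFrame (a b c : A) (w : Fin 4 → A) :
    -b * quadricFrame a b c w 0 ^ 2 + a * quadricFrame a b c w 1 ^ 2 +
      (b - a) * quadricFrame a b c w 3 ^ 2 =
    4 * (a - b) * (w 2 * w 3 - 2 * (a * b * c) * w 1 * w 0 - w 3 ^ 2 -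
      (a * b + b * c + a * c) * w 3 * w 0 - a * b * c * (a + b + c) * w 0 ^ 2 -
        a * b * (w 1 ^ 2 - w 0 * w 2)) := by
  simp [quadricFrame]
  ring

/-- Forms in the coordinates `w` that define the map to the Weierstrass cubic: the functions
`x` and `y = m x - a b c` directly, and, near the two points with `w 0 = 0`, an equivalent triple
of linear forms. -/
def quadricToCubic (a b c : A) (w : Fin 4 → A) : Fin 2 → Fin 3 → A :=
  ![![w 3 * w 0, w 1 * w 3 - a * b * c * w 0 ^ 2, w 0 ^ 2],
    ![2 * (a * b * c) * w 1 + a * b * c * (a + b + c) * w 0,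
      a * b * c * (w 2 + w 3 + (a * b + b * c + a * c) * w 0) + a * b * c * (a + b + c) * w 1,
      w 2 - w 3 - (a * b + b * c + a * c) * w 0]]

/-- Forms on the Weierstrass cubic that define the coordinates `w = (1, m, m², x)`: the function
`m` is `(y + a b c) / x = (x² + (a b + b c + a c) x + a b c (a + b + c)) / (y - a b c)`. -/
def cubicToQuadric (a b c : A) (p : Fin 3 → A) : Fin 2 → Fin 4 → A :=
  ![![p 0 ^ 2, p 0 * (p 1 + a * b * c * p 2), (p 1 + a * b * c * p 2) ^ 2,
      p 1 ^ 2 - (a * b + b * c + a * c) * p 0 ^ 2 - a * b * c * (a + b + c) * (p 0 * p 2) -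
        (a * b * c) ^ 2 * p 2 ^ 2],
    ![p 2 ^ 2 * (p 1 - a * b * c * p 2) ^ 2,
      (p 0 ^ 2 + (a * b + b * c + a * c) * (p 0 * p 2) + a * b * c * (a + b + c) * p 2 ^ 2) *
        (p 2 * (p 1 - a * b * c * p 2)),
      (p 0 ^ 2 + (a * b + b * c + a * c) * (p 0 * p 2) + a * b * c * (a + b + c) * p 2 ^ 2) ^ 2,
      p 0 * p 2 * (p 1 - a * b * c * p 2) ^ 2]]

/-- The correspondence between vectors on the intersection of quadrics and on the Weierstrass
cubic: the generic pairs, and the two points at which the function `m` is infinite. -/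
def QuadricRelation (a b c : A) (v : Fin 4 → A) (p : Fin 3 → A) : Prop :=
  (∃ m x : A, m ^ 2 * x - 2 * (a * b * c) * m =
      x ^ 2 + (a * b + b * c + a * c) * x + a * b * c * (a + b + c) ∧
      v = quadricFrame a b c ![1, m, m ^ 2, x] ∧ p = ![x, m * x - a * b * c, 1]) ∨
  (v = quadricFrame a b c ![0, 0, 1, 1] ∧ p = ![0, 1, 0]) ∨
  (v = quadricFrame a b c ![0, 0, 1, 0] ∧ p = ![0, a * b * c, 1])

lemma map_quadricFrame {B : Type*} [CommRing B] (f : A →+* B) (a b c : A) (w : Fin 4 → A)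
    (i : Fin 4) :
    f (quadricFrame a b c w i) = quadricFrame (f a) (f b) (f c) (fun j => f (w j)) i := by
  have h2 : f 2 = 2 := map_ofNat f 2
  fin_cases i <;> simp [quadricFrame, h2]

lemma map_quadricCoframe {B : Type*} [CommRing B] (f : A →+* B) (a b c : A) (y : Fin 4 → A)
    (i : Fin 4) :
    f (quadricCoframe a b c y i) = quadricCoframe (f a) (f b) (f c) (fun j => f (y j)) i := by
  have h2 : f 2 = 2 := map_ofNat f 2
  fin_cases i <;> simp [quadricCoframe, h2]

lemma map_quadricToCubic {B : Type*} [CommRing B] (f : A →+* B) (a b c : A) (w : Fin 4 → A)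
    (i : Fin 2) (j : Fin 3) :
    f (quadricToCubic a b c w i j) = quadricToCubic (f a) (f b) (f c) (fun l => f (w l)) i j := by
  have h2 : f 2 = 2 := map_ofNat f 2
  fin_cases i <;> fin_cases j <;> simp [quadricToCubic, h2]

lemma map_cubicToQuadric {B : Type*} [CommRing B] (f : A →+* B) (a b c : A) (p : Fin 3 → A)
    (i : Fin 2) (j : Fin 4) :
    f (cubicToQuadric a b c p i j) = cubicToQuadric (f a) (f b) (f c) (fun l => f (p l)) i j := by
  fin_cases i <;> fin_cases j <;> simp [cubicToQuadric]

end QuadricFrame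

section QuadricRelation

variable {K : Type*} [Field K] {a b c : K}

lemma exists_quadricRelation_left (hδ : 4 * (a - b) * (b - c) * (c - a) ≠ 0)
    {y : Fin 4 → K}
    (h1 : (c - b) * y 0 ^ 2 + (a - c) * y 1 ^ 2 + (b - a) * y 2 ^ 2 = 0)
    (h2 : -b * y 0 ^ 2 + a * y 1 ^ 2 + (b - a) * y 3 ^ 2 = 0) :
    ∃ (u : K) (v : Fin 4 → K) (p : Fin 3 → K), y = u • v ∧ QuadricRelation a b c v p := by
  obtain ⟨w, rfl⟩ : ∃ w, y = quadricFrame a b c w :=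
    ⟨(4 * (a - b) * (b - c) * (c - a))⁻¹ • quadricCoframe a b c y, by
      rw [quadricFrame_smul, quadricFrame_quadricCoframe, inv_smul_smul₀ hδ]⟩
  have hab : 4 * (a - b) ≠ 0 := fun h => hδ (by rw [h]; ring)
  rw [first_quadric_quadricFrame] at h1
  rw [second_quadric_quadricFrame] at h2
  have e1 := (mul_eq_zero.1 h1).resolve_left hδ
  have e2 := (mul_eq_zero.1 h2).resolve_left hab
  rw [e1] at e2
  by_cases h0 : w 0 = 0
  · have hw1 : w 1 = 0 := by simpa [h0] using e1
    have e3 : w 3 * (w 2 - w 3) = 0 := by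
      simp only [h0, hw1] at e2
      linear_combination e2
    rcases mul_eq_zero.1 e3 with h3 | h3
    · refine ⟨w 2, _, _, ?_, Or.inr (Or.inr ⟨rfl, rfl⟩)⟩
      rw [← quadricFrame_smul]
      congr 1
      ext i
      fin_cases i <;> simp [h0, hw1, h3]
    · refine ⟨w 2, _, _, ?_, Or.inr (Or.inl ⟨rfl, rfl⟩)⟩
      rw [← quadricFrame_smul]
      congr 1
      ext i
      fin_cases i <;> simp [h0, hw1, sub_eq_zero.1 h3]
  · refine ⟨w 0, _, _, ?_, Or.inl ⟨w 1 / w 0, w 3 / w 0, ?_, rfl, rfl⟩⟩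
    · rw [← quadricFrame_smul]
      congr 1
      ext i
      fin_cases i
      · simp
      · simp; field_simp
      · simp; field_simp; linear_combination -e1
      · simp; field_simp
    · field_simp
      linear_combination w 3 * e1 + w 0 * e2

lemma exists_quadricRelation_right (h2 : (2 : K) ≠ 0) {p : Fin 3 → K}
    (h : p 1 ^ 2 * p 2 - (p 0 ^ 3 + (a * b + b * c + a * c) * p 0 ^ 2 * p 2 +
      a * b * c * (a + b + c) * p 0 * p 2 ^ 2 + (a * b * c) ^ 2 * p 2 ^ 3) = 0) :
    ∃ (u : K) (v : Fin 4 → K) (q : Fin 3 → K), p = u • q ∧ QuadricRelation a b c v q := by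
  by_cases hz : p 2 = 0
  · have hx : p 0 = 0 := by simpa [hz] using h
    refine ⟨p 1, _, _, ?_, Or.inr (Or.inl ⟨rfl, rfl⟩)⟩
    ext i
    fin_cases i <;> simp [hz, hx]
  by_cases hx : p 0 = 0
  · have hy : (p 1 - a * b * c * p 2) * (p 1 + a * b * c * p 2) = 0 := by
      refine mul_left_cancel₀ hz ?_
      rw [hx] at h
      linear_combination h
    rcases mul_eq_zero.1 hy with hy | hy
    · refine ⟨p 2, _, _, ?_, Or.inr (Or.inr ⟨rfl, rfl⟩)⟩
      ext i
      fin_cases i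
      · simp [hx]
      · simp; linear_combination hy
      · simp
    · refine ⟨p 2, _, _, ?_, Or.inl ⟨-(a + b + c) / 2, 0, ?_, rfl, rfl⟩⟩
      · ext i
        fin_cases i
        · simp [hx]
        · simp; linear_combination hy
        · simp
      · field_simp
        ring
  · refine ⟨p 2, _, _, ?_, Or.inl ⟨(p 1 + a * b * c * p 2) / p 0, p 0 / p 2, ?_, rfl, rfl⟩⟩
    · ext i
      fin_cases i
      · simp; field_simp
      · simp; field_simp; ring
      · simp
    · field_simp
      linear_combination h

lemma QuadricRelation.quadrics {v : Fin 4 → K} {p : Fin 3 → K} (h : QuadricRelation a b c v p) :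
    (c - b) * v 0 ^ 2 + (a - c) * v 1 ^ 2 + (b - a) * v 2 ^ 2 = 0 ∧
      -b * v 0 ^ 2 + a * v 1 ^ 2 + (b - a) * v 3 ^ 2 = 0 := by
  obtain ⟨m, x, hmx, rfl, rfl⟩ | ⟨rfl, rfl⟩ | ⟨rfl, rfl⟩ := h <;>
    rw [first_quadric_quadricFrame, second_quadric_quadricFrame]
  · constructor
    · simp
    · simp
      right
      linear_combination hmx
  · simp
  · simp

lemma QuadricRelation.cubic {v : Fin 4 → K} {p : Fin 3 → K} (h : QuadricRelation a b c v p) :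
    p 1 ^ 2 * p 2 - (p 0 ^ 3 + (a * b + b * c + a * c) * p 0 ^ 2 * p 2 +
      a * b * c * (a + b + c) * p 0 * p 2 ^ 2 + (a * b * c) ^ 2 * p 2 ^ 3) = 0 := by
  obtain ⟨m, x, hmx, rfl, rfl⟩ | ⟨rfl, rfl⟩ | ⟨rfl, rfl⟩ := h
  · simp
    linear_combination x * hmx
  · simp
  · simp

lemma QuadricRelation.quadricToCubic_eq {v : Fin 4 → K} {p : Fin 3 → K}
    (h : QuadricRelation a b c v p) (i : Fin 2) :
    ∃ u : K, quadricToCubic a b c (quadricCoframe a b c v) i = u • p := by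
  obtain ⟨m, x, hmx, rfl, rfl⟩ | ⟨rfl, rfl⟩ | ⟨rfl, rfl⟩ := h <;>
    rw [quadricCoframe_quadricFrame] <;> set δ := 4 * (a - b) * (b - c) * (c - a)
  · fin_cases i
    · refine ⟨δ ^ 2, ?_⟩
      ext j
      fin_cases j <;> simp [quadricToCubic] <;> ring
    · refine ⟨δ * (m ^ 2 - x - (a * b + b * c + a * c)), ?_⟩
      ext j
      fin_cases j
      · simp [quadricToCubic]; linear_combination -δ * hmx
      · simp [quadricToCubic]; linear_combination -δ * m * hmx
      · simp [quadricToCubic]; ring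
  · fin_cases i
    · refine ⟨0, ?_⟩
      ext j
      fin_cases j <;> simp [quadricToCubic]
    · refine ⟨2 * (a * b * c) * δ, ?_⟩
      ext j
      fin_cases j <;> simp [quadricToCubic]
      ring
  · fin_cases i
    · refine ⟨0, ?_⟩
      ext j
      fin_cases j <;> simp [quadricToCubic]
    · refine ⟨δ, ?_⟩
      ext j
      fin_cases j <;> simp [quadricToCubic]
      ring

lemma QuadricRelation.exists_quadricToCubic_ne_zero (h2 : (2 : K) ≠ 0) (habc : a * b * c ≠ 0)
    (hδ : 4 * (a - b) * (b - c) * (c - a) ≠ 0) {v : Fin 4 → K} {p : Fin 3 → K}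
    (h : QuadricRelation a b c v p) :
    ∃ i, quadricToCubic a b c (quadricCoframe a b c v) i ≠ 0 := by
  obtain ⟨m, x, hmx, rfl, rfl⟩ | ⟨rfl, rfl⟩ | ⟨rfl, rfl⟩ := h <;>
    rw [quadricCoframe_quadricFrame] <;> set δ := 4 * (a - b) * (b - c) * (c - a)
  · exact ⟨0, fun h => by simpa [quadricToCubic, hδ] using congrFun h 2⟩
  · refine ⟨1, fun h => ?_⟩
    have := congrFun h 1
    simp [quadricToCubic] at this
    rcases this with h | h
    · exact habc (by simpa using h)
    · exact mul_ne_zero h2 hδ (by rw [two_mul, h])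
  · exact ⟨1, fun h => by simpa [quadricToCubic, hδ] using congrFun h 2⟩

lemma QuadricRelation.cubicToQuadric_eq {v : Fin 4 → K} {p : Fin 3 → K}
    (h : QuadricRelation a b c v p) (i : Fin 2) :
    ∃ u : K, quadricFrame a b c (cubicToQuadric a b c p i) = u • v := by
  suffices h' : ∃ (u : K) (w : Fin 4 → K), v = quadricFrame a b c w ∧
      cubicToQuadric a b c p i = u • w by
    obtain ⟨u, w, rfl, hw⟩ := h'
    exact ⟨u, by rw [hw, quadricFrame_smul]⟩
  obtain ⟨m, x, hmx, rfl, rfl⟩ | ⟨rfl, rfl⟩ | ⟨rfl, rfl⟩ := h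
  · fin_cases i
    · refine ⟨x ^ 2, _, rfl, ?_⟩
      ext j
      fin_cases j
      · simp [cubicToQuadric]
      · simp [cubicToQuadric]; ring
      · simp [cubicToQuadric]; ring
      · simp [cubicToQuadric]; linear_combination x * hmx
    · refine ⟨(m * x - 2 * (a * b * c)) ^ 2, _, rfl, ?_⟩
      ext j
      fin_cases j
      · simp [cubicToQuadric]; ring
      · simp [cubicToQuadric]; linear_combination -(m * x - 2 * (a * b * c)) * hmx
      · simp [cubicToQuadric]
        linear_combination -(x ^ 2 + (a * b + b * c + a * c) * x + a * b * c * (a + b + c) +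
          (m ^ 2 * x - 2 * (a * b * c) * m)) * hmx
      · simp [cubicToQuadric]; ring
  · fin_cases i
    · refine ⟨1, _, rfl, ?_⟩
      ext j
      fin_cases j <;> simp [cubicToQuadric]
    · refine ⟨0, _, rfl, ?_⟩
      ext j
      fin_cases j <;> simp [cubicToQuadric]
  · fin_cases i
    · refine ⟨4 * (a * b * c) ^ 2, _, rfl, ?_⟩
      ext j
      fin_cases j <;> simp [cubicToQuadric]
      ring
    · refine ⟨(a * b * c * (a + b + c)) ^ 2, _, rfl, ?_⟩
      ext j
      fin_cases j <;> simp [cubicToQuadric]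

lemma QuadricRelation.exists_cubicToQuadric_ne_zero (h2 : (2 : K) ≠ 0) (habc : a * b * c ≠ 0)
    (hδ : 4 * (a - b) * (b - c) * (c - a) ≠ 0) {v : Fin 4 → K} {p : Fin 3 → K}
    (h : QuadricRelation a b c v p) :
    ∃ i, quadricFrame a b c (cubicToQuadric a b c p i) ≠ 0 := by
  suffices h' : ∃ i, cubicToQuadric a b c p i ≠ 0 by
    obtain ⟨i, hi⟩ := h'
    refine ⟨i, fun h0 => hi ?_⟩
    have := quadricCoframe_quadricFrame a b c (cubicToQuadric a b c p i)
    rw [h0, eq_comm] at this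
    refine (smul_eq_zero.1 (this.trans ?_)).resolve_left hδ
    ext j
    fin_cases j <;> simp [quadricCoframe]
  obtain ⟨m, x, hmx, rfl, rfl⟩ | ⟨rfl, rfl⟩ | ⟨rfl, rfl⟩ := h
  · by_cases hx : x = 0
    · refine ⟨1, fun h => ?_⟩
      have := congrFun h 0
      simp [cubicToQuadric, hx] at this
      refine mul_ne_zero h2 habc ?_
      linear_combination -this
    · exact ⟨0, fun h => by simpa [cubicToQuadric, hx] using congrFun h 0⟩
  · exact ⟨0, fun h => by simpa [cubicToQuadric] using congrFun h 2⟩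
  · refine ⟨0, fun h => ?_⟩
    have := congrFun h 2
    simp [cubicToQuadric] at this
    refine mul_ne_zero h2 habc ?_
    linear_combination this

end QuadricRelation

section QuadricIsomorphism

variable {k : Type*} [Field k]

lemma _root_.MvPolynomial.IsHomogeneous.zero_mul {σ : Type*} {φ ψ : MvPolynomial σ k} {n : ℕ}
    (hφ : φ.IsHomogeneous 0) (hψ : ψ.IsHomogeneous n) : (φ * ψ).IsHomogeneous n := by
  simpa using hφ.mul hψ

lemma isHomogeneous_two {σ : Type*} : (2 : MvPolynomial σ k).IsHomogeneous 0 := by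
  have h := isHomogeneous_C σ (2 : k)
  rwa [map_ofNat] at h

lemma isHomogeneous_coeff {σ : Type*} (t : k) : (C t : MvPolynomial σ k).IsHomogeneous 0 :=
  isHomogeneous_C σ t

lemma isHomogeneous_sub {σ : Type*} {φ ψ : MvPolynomial σ k} {n : ℕ} (hφ : φ.IsHomogeneous n)
    (hψ : ψ.IsHomogeneous n) : (φ - ψ).IsHomogeneous n :=
  hφ.sub hψ

lemma isHomogeneous_quadricCoframe (a b c : k) (i : Fin 4) :
    (quadricCoframe (C a) (C b) (C c) (X : Fin 4 → MvPolynomial (Fin 4) k) i).IsHomogeneous 1 := by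
  have hX : ∀ i : Fin 4, (X i : MvPolynomial (Fin 4) k).IsHomogeneous 1 := isHomogeneous_X k
  fin_cases i <;> simp only [quadricCoframe, Fin.zero_eta, Fin.mk_one, Fin.reduceFinMk,
    Matrix.cons_val, Matrix.cons_val_zero, Matrix.cons_val_one] <;>
  with_reducible repeat' first
    | exact hX _
    | exact isHomogeneous_coeff _
    | exact isHomogeneous_two
    | apply IsHomogeneous.add
    | apply isHomogeneous_sub
    | apply IsHomogeneous.zero_mul

lemma isHomogeneous_quadricFrame {σ : Type*} (a b c : k) {w : Fin 4 → MvPolynomial σ k} {n : ℕ}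
    (hw : ∀ i, (w i).IsHomogeneous n) (i : Fin 4) :
    (quadricFrame (C a) (C b) (C c) w i).IsHomogeneous n := by
  fin_cases i <;> simp only [quadricFrame, Fin.zero_eta, Fin.mk_one, Fin.reduceFinMk,
    Matrix.cons_val, Matrix.cons_val_zero, Matrix.cons_val_one] <;>
  with_reducible repeat' first
    | exact hw _
    | exact isHomogeneous_coeff _
    | exact isHomogeneous_two
    | apply IsHomogeneous.add
    | apply isHomogeneous_sub
    | apply IsHomogeneous.zero_mul

lemma isHomogeneous_quadricToCubic {σ : Type*} (a b c : k) {w : Fin 4 → MvPolynomial σ k}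
    (hw : ∀ i, (w i).IsHomogeneous 1) (i : Fin 2) (j : Fin 3) :
    (quadricToCubic (C a) (C b) (C c) w i j).IsHomogeneous (![2, 1] i) := by
  have hw2 : ∀ i j, (w i * w j).IsHomogeneous 2 := fun i j => (hw i).mul (hw j)
  have hw2' : ∀ i, (w i ^ 2).IsHomogeneous 2 := fun i => (hw i).pow 2
  fin_cases i <;> fin_cases j <;> simp only [quadricToCubic, Fin.zero_eta, Fin.mk_one,
    Fin.reduceFinMk, Matrix.cons_val, Matrix.cons_val_zero, Matrix.cons_val_one] <;>
  with_reducible repeat' first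
    | exact hw _
    | exact hw2 _ _
    | exact hw2' _
    | exact isHomogeneous_coeff _
    | exact isHomogeneous_two
    | apply IsHomogeneous.add
    | apply isHomogeneous_sub
    | apply IsHomogeneous.zero_mul

lemma isHomogeneous_cubicToQuadric (a b c : k) (i : Fin 2) (j : Fin 4) :
    (cubicToQuadric (C a) (C b) (C c) (X : Fin 3 → MvPolynomial (Fin 3) k) i j).IsHomogeneous
      (![2, 4] i) := by
  have hX : ∀ i : Fin 3, (X i : MvPolynomial (Fin 3) k).IsHomogeneous 1 := isHomogeneous_X k
  have h0 : ∀ t : k, (C t : MvPolynomial (Fin 3) k).IsHomogeneous 0 := isHomogeneous_C _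
  have habc : (C a * C b * C c : MvPolynomial (Fin 3) k).IsHomogeneous 0 :=
    ((h0 a).mul (h0 b)).mul (h0 c)
  have h1 : (X 1 + C a * C b * C c * X 2 : MvPolynomial (Fin 3) k).IsHomogeneous 1 :=
    (hX 1).add (.zero_mul habc (hX 2))
  have h2 : (X 1 - C a * C b * C c * X 2 : MvPolynomial (Fin 3) k).IsHomogeneous 1 :=
    (hX 1).sub (.zero_mul habc (hX 2))
  have h3 : (C a * C b + C b * C c + C a * C c : MvPolynomial (Fin 3) k).IsHomogeneous 0 :=
    (((h0 a).mul (h0 b)).add ((h0 b).mul (h0 c))).add ((h0 a).mul (h0 c))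
  have h4 : (C a * C b * C c * (C a + C b + C c) : MvPolynomial (Fin 3) k).IsHomogeneous 0 :=
    habc.mul (((h0 a).add (h0 b)).add (h0 c))
  have h5 : (X 0 ^ 2 + (C a * C b + C b * C c + C a * C c) * (X 0 * X 2) +
      C a * C b * C c * (C a + C b + C c) * X 2 ^ 2 : MvPolynomial (Fin 3) k).IsHomogeneous 2 :=
    (((hX 0).pow 2).add (.zero_mul h3 ((hX 0).mul (hX 2)))).add (.zero_mul h4 ((hX 2).pow 2))
  fin_cases i <;> fin_cases j <;> simp only [cubicToQuadric, Fin.zero_eta, Fin.mk_one,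
    Fin.reduceFinMk, Matrix.cons_val, Matrix.cons_val_zero, Matrix.cons_val_one]
  · exact (hX 0).pow 2
  · exact (hX 0).mul h1
  · exact h1.pow 2
  · exact ((((hX 1).pow 2).sub (.zero_mul h3 ((hX 0).pow 2))).sub
      (.zero_mul h4 ((hX 0).mul (hX 2)))).sub (.zero_mul (habc.pow 2) ((hX 2).pow 2))
  · exact ((hX 2).pow 2).mul (h2.pow 2)
  · exact h5.mul ((hX 2).mul h2)
  · exact h5.pow 2
  · exact ((hX 0).mul (hX 2)).mul (h2.pow 2)

/-- The Weierstrass curve `y² = (x + a b) (x + b c) (x + c a)`. -/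
def quadricJacobian (a b c : k) : WeierstrassCurve k :=
  ⟨0, a * b + b * c + a * c, 0, a * b * c * (a + b + c), (a * b * c) ^ 2⟩

/-- The poles of the function `m` are the points `[1 : 1 : 1 : -1]` and `[1 : 1 : 1 : 1]`. They
correspond to the point at infinity and to `(0, a b c)`. -/
theorem isIsomorphic_quadricJacobian [CharZero k] {a b c : k} (hab : a ≠ b) (hbc : b ≠ c)
    (hca : c ≠ a) (habc : a * b * c ≠ 0) :
    IsIsomorphic (Ideal.span {C (c - b) * X 0 ^ 2 + C (a - c) * X 1 ^ 2 + C (b - a) * X 2 ^ 2,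
        C (-b) * X 0 ^ 2 + C a * X 1 ^ 2 + C (b - a) * X 3 ^ 2} : Ideal (MvPolynomial (Fin 4) k))
      (Ideal.span {(quadricJacobian a b c).toProjective.polynomial}) := by
  have : CharZero (AlgebraicClosure k) := algebraRat.charZero _
  set f := algebraMap k (AlgebraicClosure k) with hf
  have hδ : 4 * (f a - f b) * (f b - f c) * (f c - f a) ≠ 0 := by
    simp [← map_sub, sub_ne_zero, hab, hbc, hca]
  have habc' : f a * f b * f c ≠ 0 := by
    simpa using habc
  have hev : ∀ (i : Fin 2) (v : Fin 4 → AlgebraicClosure k),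
      evalTuple (quadricToCubic (C a) (C b) (C c)
        (quadricCoframe (C a) (C b) (C c) (X : Fin 4 → MvPolynomial (Fin 4) k)) i) v =
      quadricToCubic (f a) (f b) (f c) (quadricCoframe (f a) (f b) (f c) v) i := by
    intro i v
    ext j
    have h := map_quadricToCubic (aeval v : MvPolynomial (Fin 4) k →ₐ[k] _).toRingHom (C a) (C b)
      (C c) (quadricCoframe (C a) (C b) (C c) X) i j
    have h' := map_quadricCoframe (aeval v : MvPolynomial (Fin 4) k →ₐ[k] _).toRingHom (C a) (C b)
      (C c) X
    simp only [AlgHom.toRingHom_eq_coe, RingHom.coe_coe, aeval_C, aeval_X] at h h'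
    simp only [h'] at h
    exact h
  have hev' : ∀ (i : Fin 2) (p : Fin 3 → AlgebraicClosure k),
      evalTuple (quadricFrame (C a) (C b) (C c) (cubicToQuadric (C a) (C b) (C c)
        (X : Fin 3 → MvPolynomial (Fin 3) k) i)) p =
      quadricFrame (f a) (f b) (f c) (cubicToQuadric (f a) (f b) (f c) p i) := by
    intro i p
    ext j
    have h := map_quadricFrame (aeval p : MvPolynomial (Fin 3) k →ₐ[k] _).toRingHom (C a) (C b)
      (C c) (cubicToQuadric (C a) (C b) (C c) X i) j
    have h' := map_cubicToQuadric (aeval p : MvPolynomial (Fin 3) k →ₐ[k] _).toRingHom (C a) (C b)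
      (C c) X
    simp only [AlgHom.toRingHom_eq_coe, RingHom.coe_coe, aeval_C, aeval_X] at h h'
    simp only [h'] at h
    exact h
  refine isIsomorphic_of_relation ?_ ?_
    (fun i j => isHomogeneous_quadricToCubic a b c (isHomogeneous_quadricCoframe a b c) i j)
    (fun i j => isHomogeneous_quadricFrame a b c (isHomogeneous_cubicToQuadric a b c i) j)
    (QuadricRelation (f a) (f b) (f c)) ?_ ?_ ?_ ?_ ?_ ?_ ?_ ?_
  · rintro _ (rfl | rfl)
    · exact ⟨2, isHomogeneous_diagonal _ _ _ 2 0 1 2⟩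
    · exact ⟨2, isHomogeneous_diagonal _ _ _ 2 0 1 3⟩
  · rintro _ rfl
    exact ⟨3, isHomogeneous_weierstrass _⟩
  · intro v _ hv
    exact exists_quadricRelation_left hδ (by simpa using hv _ (Set.mem_insert _ _))
      (by simpa using hv _ (Set.mem_insert_of_mem _ rfl))
  · intro p _ hp
    have := hp _ rfl
    rw [quadricJacobian, aeval_weierstrass] at this
    exact exists_quadricRelation_right two_ne_zero (by simpa using this)
  · rintro v p h _ (rfl | rfl)
    · simpa using h.quadrics.1
    · simpa using h.quadrics.2
  · rintro v p h _ rfl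
    rw [quadricJacobian, aeval_weierstrass]
    simpa using h.cubic
  · intro v p h i
    rw [hev]
    exact h.quadricToCubic_eq i
  · intro v p h
    simp only [hev]
    exact h.exists_quadricToCubic_ne_zero two_ne_zero habc' hδ
  · intro v p h i
    rw [hev']
    exact h.cubicToQuadric_eq i
  · intro v p h
    simp only [hev']
    exact h.exists_cubicToQuadric_ne_zero two_ne_zero habc' hδ

end QuadricIsomorphism

/-! ### The diagonal plane cubic as a Weierstrass cubic -/

section CubicFrame

variable {A : Type*} [CommRing A]

/-- The three diagonal coordinates, in terms of the coordinates `w = (x, m, 1)` that the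
Weierstrass function `x` and the slope `m` of the line through a fixed point provide. -/
def cubicFrame (a b c : A) (w : Fin 3 → A) : Fin 3 → A :=
  ![w 0 + (b - c) * w 1 + (2 * (b * c) - a * b - c * a) * w 2,
    w 0 + (c - a) * w 1 + (2 * (c * a) - b * c - a * b) * w 2,
    w 0 + (a - b) * w 1 + (2 * (a * b) - c * a - b * c) * w 2]

/-- The inverse of `cubicFrame`, up to the factor `9 a b c`, when `a + b + c = 0`. -/
def cubicCoframe (a b c : A) (y : Fin 3 → A) : Fin 3 → A :=
  ![3 * (a * b * c) * (y 0 + y 1 + y 2),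
    a * (c - b) * y 0 + b * (a - c) * y 1 + c * (b - a) * y 2,
    a * y 0 + b * y 1 + c * y 2]

/-- The forms that define the map `(x, m) ↦ (x, m (x - e) - t)` to a Weierstrass cubic through
the point `(e, t)`: the functions themselves, and an equivalent triple near the points at
infinity. -/
def slopeToWeierstrass (e t : A) (w : Fin 3 → A) : Fin 2 → Fin 3 → A :=
  let g := e * w 1 ^ 2 + 2 * t * (w 1 * w 2) + (w 0 ^ 2 + e * (w 0 * w 2) + e ^ 2 * w 2 ^ 2)
  ![![w 0 * w 2, w 1 * (w 0 - e * w 2) - t * w 2 ^ 2, w 2 ^ 2],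
    ![w 1 * g, t * w 1 ^ 3 + w 0 * g + w 1 ^ 2 * (e * w 0 + e ^ 2 * w 2), w 1 ^ 3]]

/-- The forms that define the map `(x, y) ↦ (x, (y + t) / (x - e))` on a Weierstrass cubic through
the point `(e, t)`, and an equivalent triple near the point at infinity and near `(e, -t)`. -/
def weierstrassToSlope (e t : A) (p : Fin 3 → A) : Fin 2 → Fin 3 → A :=
  let f := p 1 ^ 2 - (t ^ 2 - e ^ 3) * p 2 ^ 2
  ![![p 0 * (p 0 - e * p 2), (p 1 + t * p 2) * p 2, p 2 * (p 0 - e * p 2)],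
    ![f * (p 1 - t * p 2), e * p 0 ^ 3 + e ^ 2 * (p 0 ^ 2 * p 2) + p 0 * f,
      p 0 ^ 2 * (p 1 - t * p 2)]]

/-- The correspondence between vectors on the diagonal cubic and on the Weierstrass cubic: the
generic pairs, and the two points at which the slope coordinates are at infinity. -/
def CubicRelation (a b c e t : A) (v p : Fin 3 → A) : Prop :=
  (∃ m x : A, m ^ 2 * (x - e) - 2 * t * m = x ^ 2 + x * e + e ^ 2 ∧
      v = cubicFrame a b c ![x, m, 1] ∧ p = ![x, m * (x - e) - t, 1]) ∨
  (v = cubicFrame a b c ![1, 0, 0] ∧ p = ![0, 1, 0]) ∨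
  (v = cubicFrame a b c ![0, 1, 0] ∧ p = ![e, t, 1])

lemma map_cubicFrame {B : Type*} [CommRing B] (f : A →+* B) (a b c : A) (w : Fin 3 → A)
    (i : Fin 3) :
    f (cubicFrame a b c w i) = cubicFrame (f a) (f b) (f c) (fun j => f (w j)) i := by
  have h2 : f 2 = 2 := map_ofNat f 2
  fin_cases i <;> simp [cubicFrame, h2]

lemma map_cubicCoframe {B : Type*} [CommRing B] (f : A →+* B) (a b c : A) (y : Fin 3 → A)
    (i : Fin 3) :
    f (cubicCoframe a b c y i) = cubicCoframe (f a) (f b) (f c) (fun j => f (y j)) i := by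
  have h3 : f 3 = 3 := map_ofNat f 3
  fin_cases i <;> simp [cubicCoframe, h3]

lemma map_slopeToWeierstrass {B : Type*} [CommRing B] (f : A →+* B) (e t : A) (w : Fin 3 → A)
    (i : Fin 2) (j : Fin 3) :
    f (slopeToWeierstrass e t w i j) = slopeToWeierstrass (f e) (f t) (fun l => f (w l)) i j := by
  have h2 : f 2 = 2 := map_ofNat f 2
  fin_cases i <;> fin_cases j <;> simp [slopeToWeierstrass, h2]

lemma map_weierstrassToSlope {B : Type*} [CommRing B] (f : A →+* B) (e t : A) (p : Fin 3 → A)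
    (i : Fin 2) (j : Fin 3) :
    f (weierstrassToSlope e t p i j) = weierstrassToSlope (f e) (f t) (fun l => f (p l)) i j := by
  fin_cases i <;> fin_cases j <;> simp [weierstrassToSlope]

lemma cubicFrame_smul (a b c u : A) (w : Fin 3 → A) :
    cubicFrame a b c (u • w) = u • cubicFrame a b c w := by
  ext i
  fin_cases i <;> simp [cubicFrame] <;> ring

variable {a b c : A}

lemma cubicCoframe_cubicFrame (h : a + b + c = 0) (w : Fin 3 → A) :
    cubicCoframe a b c (cubicFrame a b c w) = (9 * (a * b * c)) • w := by
  obtain rfl : c = -a - b := by linear_combination h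
  ext i
  fin_cases i <;> simp [cubicCoframe, cubicFrame] <;> ring

lemma cubicFrame_cubicCoframe (h : a + b + c = 0) (y : Fin 3 → A) :
    cubicFrame a b c (cubicCoframe a b c y) = (9 * (a * b * c)) • y := by
  obtain rfl : c = -a - b := by linear_combination h
  ext i
  fin_cases i <;> simp [cubicCoframe, cubicFrame] <;> ring

lemma diagonal_cubicFrame (h : a + b + c = 0) {e t : A} (he : e = -(a * b + b * c + c * a))
    (ht : 2 * t = b * c * (b - c) + c * a * (c - a) + a * b * (a - b)) (w : Fin 3 → A) :
    a * cubicFrame a b c w 0 ^ 3 + b * cubicFrame a b c w 1 ^ 3 + c * cubicFrame a b c w 2 ^ 3 =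
      -27 * (a * b * c) * (w 1 ^ 2 * (w 0 - e * w 2) - 2 * t * w 1 * w 2 ^ 2 -
        w 2 * (w 0 ^ 2 + w 0 * (e * w 2) + e ^ 2 * w 2 ^ 2)) := by
  obtain rfl : c = -a - b := by linear_combination h
  rw [ht, he]
  simp [cubicFrame]
  ring

end CubicFrame

section CubicRelation

variable {K : Type*} [Field K] {a b c e t : K}

lemma exists_cubicRelation_left (h3 : (3 : K) ≠ 0) (habc : a * b * c ≠ 0) (h : a + b + c = 0)
    (he : e = -(a * b + b * c + c * a))
    (ht : 2 * t = b * c * (b - c) + c * a * (c - a) + a * b * (a - b)) {y : Fin 3 → K}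
    (hy : a * y 0 ^ 3 + b * y 1 ^ 3 + c * y 2 ^ 3 = 0) :
    ∃ (u : K) (v : Fin 3 → K) (p : Fin 3 → K), y = u • v ∧ CubicRelation a b c e t v p := by
  have hδ : 9 * (a * b * c) ≠ 0 :=
    mul_ne_zero (by rw [show (9 : K) = 3 * 3 by norm_num]; exact mul_ne_zero h3 h3) habc
  have hδ' : -27 * (a * b * c) ≠ 0 := by
    have := mul_ne_zero h3 hδ
    intro h0
    exact this (by linear_combination -h0)
  obtain ⟨w, rfl⟩ : ∃ w, y = cubicFrame a b c w :=
    ⟨(9 * (a * b * c))⁻¹ • cubicCoframe a b c y, by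
      rw [cubicFrame_smul, cubicFrame_cubicCoframe h, inv_smul_smul₀ hδ]⟩
  rw [diagonal_cubicFrame h he ht] at hy
  have e1 := (mul_eq_zero.1 hy).resolve_left hδ'
  by_cases h0 : w 2 = 0
  · by_cases h1 : w 1 = 0
    · refine ⟨w 0, _, _, ?_, Or.inr (Or.inl ⟨rfl, rfl⟩)⟩
      rw [← cubicFrame_smul]
      congr 1
      ext i
      fin_cases i <;> simp [h0, h1]
    · have h2 : w 0 = 0 := by simpa [h0, h1] using e1
      refine ⟨w 1, _, _, ?_, Or.inr (Or.inr ⟨rfl, rfl⟩)⟩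
      rw [← cubicFrame_smul]
      congr 1
      ext i
      fin_cases i <;> simp [h0, h2]
  · refine ⟨w 2, _, _, ?_, Or.inl ⟨w 1 / w 2, w 0 / w 2, ?_, rfl, rfl⟩⟩
    · rw [← cubicFrame_smul]
      congr 1
      ext i
      fin_cases i
      · simp; field_simp
      · simp; field_simp
      · simp
    · field_simp
      linear_combination e1

lemma exists_cubicRelation_right (h2 : (2 : K) ≠ 0) (ht : t ≠ 0) {p : Fin 3 → K}
    (h : p 1 ^ 2 * p 2 - (p 0 ^ 3 + (t ^ 2 - e ^ 3) * p 2 ^ 3) = 0) :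
    ∃ (u : K) (v : Fin 3 → K) (q : Fin 3 → K), p = u • q ∧ CubicRelation a b c e t v q := by
  by_cases hz : p 2 = 0
  · have hx : p 0 = 0 := by simpa [hz] using h
    refine ⟨p 1, _, _, ?_, Or.inr (Or.inl ⟨rfl, rfl⟩)⟩
    ext i
    fin_cases i <;> simp [hz, hx]
  by_cases hx : p 0 - e * p 2 = 0
  · have hx' : p 0 = e * p 2 := sub_eq_zero.1 hx
    have hy : (p 1 - t * p 2) * (p 1 + t * p 2) = 0 := by
      refine mul_left_cancel₀ hz ?_
      rw [hx'] at h
      linear_combination h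
    rcases mul_eq_zero.1 hy with hy | hy
    · refine ⟨p 2, _, _, ?_, Or.inr (Or.inr ⟨rfl, rfl⟩)⟩
      ext i
      fin_cases i
      · simp [hx', mul_comm]
      · simp; linear_combination hy
      · simp
    · refine ⟨p 2, _, _, ?_, Or.inl ⟨-(3 * e ^ 2) / (2 * t), e, ?_, rfl, rfl⟩⟩
      · ext i
        fin_cases i
        · simp [hx', mul_comm]
        · simp; linear_combination hy
        · simp
      · field_simp
        ring
  · generalize hd : p 0 - e * p 2 = d at hx
    have hd' : p 0 = d + e * p 2 := by linear_combination hd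
    refine ⟨p 2, _, _, ?_, Or.inl ⟨(p 1 + t * p 2) / d, p 0 / p 2, ?_, rfl, rfl⟩⟩
    · ext i
      fin_cases i
      · simp; field_simp
      · simp; rw [hd']; field_simp; ring
      · simp
    · rw [hd'] at h ⊢
      field_simp
      linear_combination d * h

lemma CubicRelation.diagonal (hsum : a + b + c = 0) (he : e = -(a * b + b * c + c * a))
    (ht : 2 * t = b * c * (b - c) + c * a * (c - a) + a * b * (a - b)) {v p : Fin 3 → K}
    (h : CubicRelation a b c e t v p) : a * v 0 ^ 3 + b * v 1 ^ 3 + c * v 2 ^ 3 = 0 := by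
  obtain ⟨m, x, hmx, rfl, rfl⟩ | ⟨rfl, rfl⟩ | ⟨rfl, rfl⟩ := h <;>
    rw [diagonal_cubicFrame hsum he ht]
  · simp
    right
    linear_combination hmx
  · simp
  · simp

lemma CubicRelation.cubic {v p : Fin 3 → K} (h : CubicRelation a b c e t v p) :
    p 1 ^ 2 * p 2 - (p 0 ^ 3 + (t ^ 2 - e ^ 3) * p 2 ^ 3) = 0 := by
  obtain ⟨m, x, hmx, rfl, rfl⟩ | ⟨rfl, rfl⟩ | ⟨rfl, rfl⟩ := h
  · simp
    linear_combination (x - e) * hmx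
  · simp
  · simp

lemma CubicRelation.slopeToWeierstrass_eq (hsum : a + b + c = 0) {v p : Fin 3 → K}
    (h : CubicRelation a b c e t v p) (i : Fin 2) :
    ∃ u : K, slopeToWeierstrass e t (cubicCoframe a b c v) i = u • p := by
  obtain ⟨m, x, hmx, rfl, rfl⟩ | ⟨rfl, rfl⟩ | ⟨rfl, rfl⟩ := h <;>
    rw [cubicCoframe_cubicFrame hsum] <;> set δ := 9 * (a * b * c)
  · fin_cases i
    · refine ⟨δ ^ 2, ?_⟩
      ext j
      fin_cases j <;> simp [slopeToWeierstrass] <;> ring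
    · refine ⟨δ ^ 3 * m ^ 3, ?_⟩
      ext j
      fin_cases j
      · simp [slopeToWeierstrass]; linear_combination -δ ^ 3 * m * hmx
      · simp [slopeToWeierstrass]; linear_combination -δ ^ 3 * (m ^ 2 + x) * hmx
      · simp [slopeToWeierstrass]; ring
  · fin_cases i
    · refine ⟨0, ?_⟩
      ext j
      fin_cases j <;> simp [slopeToWeierstrass]
    · refine ⟨δ ^ 3, ?_⟩
      ext j
      fin_cases j <;> simp [slopeToWeierstrass]
      ring
  · fin_cases i
    · refine ⟨0, ?_⟩
      ext j
      fin_cases j <;> simp [slopeToWeierstrass]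
    · refine ⟨δ ^ 3, ?_⟩
      ext j
      fin_cases j <;> simp [slopeToWeierstrass] <;> ring

lemma CubicRelation.exists_slopeToWeierstrass_ne_zero (hδ : 9 * (a * b * c) ≠ 0)
    (hsum : a + b + c = 0) {v p : Fin 3 → K} (h : CubicRelation a b c e t v p) :
    ∃ i, slopeToWeierstrass e t (cubicCoframe a b c v) i ≠ 0 := by
  obtain ⟨m, x, hmx, rfl, rfl⟩ | ⟨rfl, rfl⟩ | ⟨rfl, rfl⟩ := h <;>
    rw [cubicCoframe_cubicFrame hsum] <;> set δ := 9 * (a * b * c)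
  · exact ⟨0, fun h => by simpa [slopeToWeierstrass, hδ] using congrFun h 2⟩
  · exact ⟨1, fun h => by simpa [slopeToWeierstrass, hδ] using congrFun h 1⟩
  · exact ⟨1, fun h => by simpa [slopeToWeierstrass, hδ] using congrFun h 2⟩

lemma CubicRelation.weierstrassToSlope_eq {v p : Fin 3 → K} (h : CubicRelation a b c e t v p)
    (i : Fin 2) : ∃ u : K, cubicFrame a b c (weierstrassToSlope e t p i) = u • v := by
  suffices h' : ∃ (u : K) (w : Fin 3 → K), v = cubicFrame a b c w ∧
      weierstrassToSlope e t p i = u • w by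
    obtain ⟨u, w, rfl, hw⟩ := h'
    exact ⟨u, by rw [hw, cubicFrame_smul]⟩
  obtain ⟨m, x, hmx, rfl, rfl⟩ | ⟨rfl, rfl⟩ | ⟨rfl, rfl⟩ := h
  · fin_cases i
    · refine ⟨x - e, _, rfl, ?_⟩
      ext j
      fin_cases j <;> simp [weierstrassToSlope] <;> ring
    · refine ⟨x ^ 2 * (m * (x - e) - 2 * t), _, rfl, ?_⟩
      have hf : (m * (x - e) - t) ^ 2 - (t ^ 2 - e ^ 3) = x ^ 3 := by
        linear_combination (x - e) * hmx
      ext j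
      fin_cases j
      · simp [weierstrassToSlope, hf]; ring
      · simp [weierstrassToSlope, hf]; linear_combination -x ^ 2 * hmx
      · simp [weierstrassToSlope]
        left
        ring
  · fin_cases i
    · refine ⟨0, _, rfl, ?_⟩
      ext j
      fin_cases j <;> simp [weierstrassToSlope]
    · refine ⟨1, _, rfl, ?_⟩
      ext j
      fin_cases j <;> simp [weierstrassToSlope]
  · fin_cases i
    · refine ⟨2 * t, _, rfl, ?_⟩
      ext j
      fin_cases j <;> simp [weierstrassToSlope]
      ring
    · refine ⟨3 * e ^ 4, _, rfl, ?_⟩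
      ext j
      fin_cases j <;> simp [weierstrassToSlope]
      ring

lemma CubicRelation.exists_weierstrassToSlope_ne_zero (h2 : (2 : K) ≠ 0)
    (hδ : 9 * (a * b * c) ≠ 0) (hsum : a + b + c = 0) (he : e ≠ 0) (ht : t ≠ 0)
    {v p : Fin 3 → K} (h : CubicRelation a b c e t v p) :
    ∃ i, cubicFrame a b c (weierstrassToSlope e t p i) ≠ 0 := by
  suffices h' : ∃ i, weierstrassToSlope e t p i ≠ 0 by
    obtain ⟨i, hi⟩ := h'
    refine ⟨i, fun h0 => hi ?_⟩
    have := cubicCoframe_cubicFrame hsum (weierstrassToSlope e t p i)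
    rw [h0, eq_comm] at this
    refine (smul_eq_zero.1 (this.trans ?_)).resolve_left hδ
    ext j
    fin_cases j <;> simp [cubicCoframe]
  obtain ⟨m, x, hmx, rfl, rfl⟩ | ⟨rfl, rfl⟩ | ⟨rfl, rfl⟩ := h
  · by_cases hx : x - e = 0
    · refine ⟨1, fun h => ?_⟩
      obtain rfl : x = e := sub_eq_zero.1 hx
      have := congrFun h 2
      simp [weierstrassToSlope, he] at this
      exact mul_ne_zero h2 ht (by linear_combination -this)
    · exact ⟨0, fun h => by simpa [weierstrassToSlope, hx] using congrFun h 2⟩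
  · exact ⟨1, fun h => by simpa [weierstrassToSlope] using congrFun h 0⟩
  · refine ⟨0, fun h => ?_⟩
    have := congrFun h 1
    simp [weierstrassToSlope] at this
    exact mul_ne_zero h2 ht (by linear_combination this)

end CubicRelation

section CubicIsomorphism

variable {k : Type*} [Field k]

lemma isHomogeneous_cubicCoframe (a b c : k) (i : Fin 3) :
    (cubicCoframe (C a) (C b) (C c) (X : Fin 3 → MvPolynomial (Fin 3) k) i).IsHomogeneous 1 := by
  have hX : ∀ i : Fin 3, (X i : MvPolynomial (Fin 3) k).IsHomogeneous 1 := isHomogeneous_X k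
  have h3 : (3 : MvPolynomial (Fin 3) k).IsHomogeneous 0 := by
    have h := isHomogeneous_coeff (σ := Fin 3) (3 : k)
    rwa [map_ofNat] at h
  fin_cases i <;> simp only [cubicCoframe, Fin.zero_eta, Fin.mk_one, Fin.reduceFinMk,
    Matrix.cons_val, Matrix.cons_val_zero, Matrix.cons_val_one] <;>
  with_reducible repeat' first
    | exact hX _
    | exact isHomogeneous_coeff _
    | exact h3
    | apply IsHomogeneous.add
    | apply isHomogeneous_sub
    | apply IsHomogeneous.zero_mul

lemma isHomogeneous_cubicFrame {σ : Type*} (a b c : k) {w : Fin 3 → MvPolynomial σ k} {n : ℕ}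
    (hw : ∀ i, (w i).IsHomogeneous n) (i : Fin 3) :
    (cubicFrame (C a) (C b) (C c) w i).IsHomogeneous n := by
  fin_cases i <;> simp only [cubicFrame, Fin.zero_eta, Fin.mk_one, Fin.reduceFinMk,
    Matrix.cons_val, Matrix.cons_val_zero, Matrix.cons_val_one] <;>
  with_reducible repeat' first
    | exact hw _
    | exact isHomogeneous_coeff _
    | exact isHomogeneous_two
    | apply IsHomogeneous.add
    | apply isHomogeneous_sub
    | apply IsHomogeneous.zero_mul

lemma isHomogeneous_slopeToWeierstrass {σ : Type*} (e t : k) {w : Fin 3 → MvPolynomial σ k}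
    (hw : ∀ i, (w i).IsHomogeneous 1) (i : Fin 2) (j : Fin 3) :
    (slopeToWeierstrass (C e) (C t) w i j).IsHomogeneous (![2, 3] i) := by
  have he := isHomogeneous_coeff (σ := σ) e
  have ht := isHomogeneous_coeff (σ := σ) t
  have h1 : (C e * w 1 ^ 2 + 2 * C t * (w 1 * w 2) + (w 0 ^ 2 + C e * (w 0 * w 2) +
      C e ^ 2 * w 2 ^ 2)).IsHomogeneous 2 :=
    ((he.zero_mul ((hw 1).pow 2)).add ((isHomogeneous_two.mul ht).zero_mul ((hw 1).mul (hw 2)))).add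
      ((((hw 0).pow 2).add (he.zero_mul ((hw 0).mul (hw 2)))).add
        ((he.pow 2).zero_mul ((hw 2).pow 2)))
  fin_cases i <;> fin_cases j <;> simp only [slopeToWeierstrass, Fin.zero_eta, Fin.mk_one,
    Fin.reduceFinMk, Matrix.cons_val, Matrix.cons_val_zero, Matrix.cons_val_one]
  · exact (hw 0).mul (hw 2)
  · exact ((hw 1).mul ((hw 0).sub (he.zero_mul (hw 2)))).sub (ht.zero_mul ((hw 2).pow 2))
  · exact (hw 2).pow 2
  · exact (hw 1).mul h1
  · exact ((ht.zero_mul ((hw 1).pow 3)).add ((hw 0).mul h1)).add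
      (((hw 1).pow 2).mul ((he.zero_mul (hw 0)).add ((he.pow 2).zero_mul (hw 2))))
  · exact (hw 1).pow 3

lemma isHomogeneous_weierstrassToSlope (e t : k) (i : Fin 2) (j : Fin 3) :
    (weierstrassToSlope (C e) (C t) (X : Fin 3 → MvPolynomial (Fin 3) k) i j).IsHomogeneous
      (![2, 3] i) := by
  have hX : ∀ i : Fin 3, (X i : MvPolynomial (Fin 3) k).IsHomogeneous 1 := isHomogeneous_X k
  have he := isHomogeneous_coeff (σ := Fin 3) e
  have ht := isHomogeneous_coeff (σ := Fin 3) t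
  have h1 : (X 1 ^ 2 - (C t ^ 2 - C e ^ 3) * X 2 ^ 2 : MvPolynomial (Fin 3) k).IsHomogeneous 2 :=
    ((hX 1).pow 2).sub (.zero_mul ((ht.pow 2).sub (he.pow 3)) ((hX 2).pow 2))
  have h2 : (X 1 - C t * X 2 : MvPolynomial (Fin 3) k).IsHomogeneous 1 :=
    (hX 1).sub (ht.zero_mul (hX 2))
  fin_cases i <;> fin_cases j <;> simp only [weierstrassToSlope, Fin.zero_eta, Fin.mk_one,
    Fin.reduceFinMk, Matrix.cons_val, Matrix.cons_val_zero, Matrix.cons_val_one]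
  · exact (hX 0).mul ((hX 0).sub (he.zero_mul (hX 2)))
  · exact ((hX 1).add (ht.zero_mul (hX 2))).mul (hX 2)
  · exact (hX 2).mul ((hX 0).sub (he.zero_mul (hX 2)))
  · exact h1.mul h2
  · exact ((he.zero_mul ((hX 0).pow 3)).add ((he.pow 2).zero_mul (((hX 0).pow 2).mul (hX 2)))).add
      ((hX 0).mul h1)
  · exact ((hX 0).pow 2).mul h2

/-- The Weierstrass curve `y² = x³ + (t² - e³)`, which contains the point `(e, t)`. -/
def cubicJacobian (e t : k) : WeierstrassCurve k :=
  ⟨0, 0, 0, 0, t ^ 2 - e ^ 3⟩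

/-- The point `[1 : 1 : 1]` corresponds to the point at infinity. The second equation says that `2 t`
is `-(a - b) (b - c) (c - a)`. -/
theorem isIsomorphic_cubicJacobian [CharZero k] {a b c e t : k} (hsum : a + b + c = 0)
    (habc : a * b * c ≠ 0) (he : e = -(a * b + b * c + c * a))
    (ht : 2 * t = b * c * (b - c) + c * a * (c - a) + a * b * (a - b)) (he0 : e ≠ 0)
    (ht0 : t ≠ 0) :
    IsIsomorphic (Ideal.span {C a * X 0 ^ 3 + C b * X 1 ^ 3 + C c * X 2 ^ 3} :
        Ideal (MvPolynomial (Fin 3) k))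
      (Ideal.span {(cubicJacobian e t).toProjective.polynomial}) := by
  have : CharZero (AlgebraicClosure k) := algebraRat.charZero _
  set f := algebraMap k (AlgebraicClosure k) with hf
  have hsum' : f a + f b + f c = 0 := by rw [← map_add, ← map_add, hsum, map_zero]
  have habc' : f a * f b * f c ≠ 0 := by simpa using habc
  have hδ : 9 * (f a * f b * f c) ≠ 0 := mul_ne_zero (by norm_num) habc'
  have he' : f e = -(f a * f b + f b * f c + f c * f a) := by rw [he]; simp
  have ht' : 2 * f t = f b * f c * (f b - f c) + f c * f a * (f c - f a) +
      f a * f b * (f a - f b) := by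
    have h2 : f 2 = 2 := map_ofNat f 2
    simpa [h2] using congrArg f ht
  have he0' : f e ≠ 0 := by simpa using he0
  have ht0' : f t ≠ 0 := by simpa using ht0
  have hev : ∀ (i : Fin 2) (v : Fin 3 → AlgebraicClosure k),
      evalTuple (slopeToWeierstrass (C e) (C t)
        (cubicCoframe (C a) (C b) (C c) (X : Fin 3 → MvPolynomial (Fin 3) k)) i) v =
      slopeToWeierstrass (f e) (f t) (cubicCoframe (f a) (f b) (f c) v) i := by
    intro i v
    ext j
    have h := map_slopeToWeierstrass (aeval v : MvPolynomial (Fin 3) k →ₐ[k] _).toRingHom (C e)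
      (C t) (cubicCoframe (C a) (C b) (C c) X) i j
    have h' := map_cubicCoframe (aeval v : MvPolynomial (Fin 3) k →ₐ[k] _).toRingHom (C a) (C b)
      (C c) X
    simp only [AlgHom.toRingHom_eq_coe, RingHom.coe_coe, aeval_C, aeval_X] at h h'
    simp only [h'] at h
    exact h
  have hev' : ∀ (i : Fin 2) (p : Fin 3 → AlgebraicClosure k),
      evalTuple (cubicFrame (C a) (C b) (C c) (weierstrassToSlope (C e) (C t)
        (X : Fin 3 → MvPolynomial (Fin 3) k) i)) p =
      cubicFrame (f a) (f b) (f c) (weierstrassToSlope (f e) (f t) p i) := by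
    intro i p
    ext j
    have h := map_cubicFrame (aeval p : MvPolynomial (Fin 3) k →ₐ[k] _).toRingHom (C a) (C b)
      (C c) (weierstrassToSlope (C e) (C t) X i) j
    have h' := map_weierstrassToSlope (aeval p : MvPolynomial (Fin 3) k →ₐ[k] _).toRingHom (C e)
      (C t) X
    simp only [AlgHom.toRingHom_eq_coe, RingHom.coe_coe, aeval_C, aeval_X] at h h'
    simp only [h'] at h
    exact h
  refine isIsomorphic_of_relation ?_ ?_
    (fun i j => isHomogeneous_slopeToWeierstrass e t (isHomogeneous_cubicCoframe a b c) i j)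
    (fun i j => isHomogeneous_cubicFrame a b c (isHomogeneous_weierstrassToSlope e t i) j)
    (CubicRelation (f a) (f b) (f c) (f e) (f t)) ?_ ?_ ?_ ?_ ?_ ?_ ?_ ?_
  · rintro _ rfl
    exact ⟨3, isHomogeneous_diagonal _ _ _ 3 0 1 2⟩
  · rintro _ rfl
    exact ⟨3, isHomogeneous_weierstrass _⟩
  · intro v _ hv
    exact exists_cubicRelation_left (by norm_num) habc' hsum' he' ht' (by simpa using hv _ rfl)
  · intro p _ hp
    have := hp _ rfl
    rw [cubicJacobian, aeval_weierstrass] at this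
    exact exists_cubicRelation_right two_ne_zero ht0' (by simpa using this)
  · rintro v p h _ rfl
    simpa using h.diagonal hsum' he' ht'
  · rintro v p h _ rfl
    rw [cubicJacobian, aeval_weierstrass]
    simpa using h.cubic
  · intro v p h i
    rw [hev]
    exact h.slopeToWeierstrass_eq hsum' i
  · intro v p h
    simp only [hev]
    exact h.exists_slopeToWeierstrass_ne_zero hδ hsum'
  · intro v p h i
    rw [hev']
    exact h.weierstrassToSlope_eq i
  · intro v p h
    simp only [hev']
    exact h.exists_weierstrassToSlope_ne_zero two_ne_zero hδ hsum' he0' ht0'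

end CubicIsomorphism

/-! ### Points of infinite order -/

section InfiniteOrder

variable {k : Type*} [Field k] {Γ₀ : Type*} [LinearOrderedCommGroupWithZero Γ₀]

lemma one_le_rank_of_not_isOfFinAddOrder {M : Type*} [AddCommGroup M] {P : M}
    (hP : ¬ IsOfFinAddOrder P) : 1 ≤ Module.rank ℤ M := by
  have h : LinearIndependent ℤ (fun _ : Unit => P) := by
    rw [Fintype.linearIndependent_iff]
    intro g hg i
    by_contra h0
    refine hP (isOfFinAddOrder_iff_zsmul_eq_zero.2 ⟨g i, h0, ?_⟩)
    simpa using hg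
  simpa using h.cardinal_lift_le_rank

lemma valuation_three {v : Valuation k Γ₀} (h2 : v 2 < 1) : v 3 = 1 := by
  rw [show (3 : k) = 1 + 2 by norm_num]
  exact v.map_one_add_of_lt h2

/-- Doubling on `y² = x³ + a₂ x² + a₄ x + a₆` at a place above `2`: a nonintegral `x`-coordinate
becomes larger, because the slope of the tangent has the denominator `2 y`. -/
lemma valuation_lt_valuation_double {v : Valuation k Γ₀} [NeZero (2 : k)] (h2 : v 2 < 1)
    {a₂ a₄ a₆ : k} (ha₂ : v a₂ ≤ 1) (ha₄ : v a₄ ≤ 1) (ha₆ : v a₆ ≤ 1) {x y : k} (hx : 1 < v x)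
    (h : y ^ 2 = x ^ 3 + a₂ * x ^ 2 + a₄ * x + a₆) :
    y ≠ 0 ∧ v x < v (((3 * x ^ 2 + 2 * a₂ * x + a₄) / (2 * y)) ^ 2 - a₂ - 2 * x) := by
  have hx0 : 0 < v x := zero_lt_one.trans hx
  have h20 : 0 < v 2 := v.pos_iff.2 two_ne_zero
  have hx2 : v x < v x ^ 2 := lt_self_pow₀ hx one_lt_two
  have hx3 : v x ^ 2 < v x ^ 3 := pow_lt_pow_right₀ hx (by norm_num)
  have hy : v (y ^ 2) = v x ^ 3 := by
    rw [h, add_assoc, add_assoc, v.map_add_eq_of_lt_left, map_pow]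
    rw [map_pow]
    refine v.map_add_lt ?_ (v.map_add_lt ?_ (ha₆.trans_lt (hx.trans (hx2.trans hx3))))
    · rw [map_mul, map_pow]
      exact (mul_le_of_le_one_left' ha₂).trans_lt hx3
    · rw [map_mul]
      exact (mul_le_of_le_one_left' ha₄).trans_lt (hx2.trans hx3)
  have hy0 : y ≠ 0 := by
    rintro rfl
    rw [zero_pow two_ne_zero, map_zero] at hy
    exact (pow_pos hx0 3).ne hy
  have hnum : v (3 * x ^ 2 + 2 * a₂ * x + a₄) = v x ^ 2 := by
    have h3 : v (3 * x ^ 2) = v x ^ 2 := by rw [map_mul, map_pow, valuation_three h2, one_mul]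
    rw [add_assoc, v.map_add_eq_of_lt_left, h3]
    rw [h3]
    refine v.map_add_lt ?_ (ha₄.trans_lt (hx.trans hx2))
    rw [map_mul, map_mul]
    exact (mul_le_of_le_one_left' (mul_le_one' h2.le ha₂)).trans_lt hx2
  have hslope : v x < v (((3 * x ^ 2 + 2 * a₂ * x + a₄) / (2 * y)) ^ 2) := by
    rw [div_pow, mul_pow, map_div₀, map_mul, hy, map_pow, map_pow, hnum,
      lt_div_iff₀ (mul_pos (pow_pos h20 2) (pow_pos hx0 3))]
    calc v x * (v 2 ^ 2 * v x ^ 3) = v 2 ^ 2 * (v x ^ 2) ^ 2 := by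
          rw [mul_left_comm, ← pow_succ', ← pow_mul]
      _ < 1 * (v x ^ 2) ^ 2 :=
          mul_lt_mul_of_pos_right (pow_lt_one₀ zero_le h2 two_ne_zero)
            (pow_pos (pow_pos hx0 2) 2)
      _ = (v x ^ 2) ^ 2 := one_mul _
  refine ⟨hy0, ?_⟩
  rw [sub_sub, v.map_sub_eq_of_lt_left]
  · exact hslope
  · refine v.map_add_lt (ha₂.trans_lt (hx.trans hslope)) ?_
    rw [map_mul]
    exact (mul_le_of_le_one_left' h2.le).trans_lt hslope

variable [DecidableEq k]

lemma add_self_some [NeZero (2 : k)] {a₂ a₄ a₆ x y : k}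
    (h : (WeierstrassCurve.toAffine ⟨0, a₂, 0, a₄, a₆⟩).Nonsingular x y) (hy : y ≠ 0) :
    ∃ (x' y' : k) (h' : (WeierstrassCurve.toAffine ⟨0, a₂, 0, a₄, a₆⟩).Nonsingular x' y'),
      WeierstrassCurve.Affine.Point.some _ _ h + .some _ _ h = .some _ _ h' ∧
      x' = ((3 * x ^ 2 + 2 * a₂ * x + a₄) / (2 * y)) ^ 2 - a₂ - 2 * x := by
  have hneg : y ≠ (WeierstrassCurve.toAffine ⟨0, a₂, 0, a₄, a₆⟩).negY x y := by
    intro h0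
    simp [WeierstrassCurve.Affine.negY] at h0
    refine mul_ne_zero two_ne_zero hy ?_
    linear_combination h0
  refine ⟨_, _, _, WeierstrassCurve.Affine.Point.add_self_of_Y_ne hneg, ?_⟩
  rw [WeierstrassCurve.Affine.addX, WeierstrassCurve.Affine.slope_of_Y_ne rfl hneg]
  simp [WeierstrassCurve.Affine.negY, two_mul]
  ring

/-- The valuation of the `x`-coordinate of a point, and `0` for the point at infinity. -/
def xValuation (v : Valuation k Γ₀) {E : WeierstrassCurve.Affine k} : E.Point → Γ₀
  | .zero => 0
  | .some x _ _ => v x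

lemma xValuation_lt_xValuation_add_self {v : Valuation k Γ₀} [NeZero (2 : k)] (h2 : v 2 < 1)
    {a₂ a₄ a₆ : k} (ha₂ : v a₂ ≤ 1) (ha₄ : v a₄ ≤ 1) (ha₆ : v a₆ ≤ 1)
    (Q : (WeierstrassCurve.toAffine ⟨0, a₂, 0, a₄, a₆⟩).Point) (hlt : 1 < xValuation v Q) :
    xValuation v Q < xValuation v (Q + Q) := by
  match Q, hlt with
  | .zero, hlt => exact absurd hlt (not_lt_of_ge zero_le)
  | .some x y hQ, hlt =>
    have hxy : y ^ 2 = x ^ 3 + a₂ * x ^ 2 + a₄ * x + a₆ := by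
      simpa [WeierstrassCurve.toAffine] using (WeierstrassCurve.Affine.equation_iff _ _).1 hQ.1
    obtain ⟨hy, hv⟩ := valuation_lt_valuation_double h2 ha₂ ha₄ ha₆ hlt hxy
    obtain ⟨x', y', h', hadd, rfl⟩ := add_self_some hQ hy
    rw [hadd]
    exact hv

/-- The multiples `2 ^ n • P` are pairwise distinct, since `f` increases along them. -/
lemma not_isOfFinAddOrder_of_lt_add_self {M β : Type*} [AddCommGroup M] [Preorder β] (f : M → β)
    {b : β} (hf : ∀ Q, b < f Q → f Q < f (Q + Q)) {P : M} (hP : b < f P) :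
    ¬ IsOfFinAddOrder P := by
  have hsucc : ∀ n : ℕ, 2 ^ (n + 1) • P = 2 ^ n • P + 2 ^ n • P := fun n => by
    rw [pow_succ, mul_nsmul, two_nsmul]
  have hlt : ∀ n : ℕ, b < f (2 ^ n • P) := by
    intro n
    induction n with
    | zero => simpa using hP
    | succ n ih =>
      rw [hsucc]
      exact ih.trans (hf _ ih)
  have hmono : StrictMono fun n : ℕ => f (2 ^ n • P) := by
    refine strictMono_nat_of_lt_succ fun n => ?_
    rw [hsucc]
    exact hf _ (hlt n)
  rw [← infinite_multiples]
  refine Set.infinite_of_injective_forall_mem (f := fun n : ℕ => 2 ^ n • P) (fun m n hmn => ?_)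
    fun n => ⟨2 ^ n, rfl⟩
  by_contra hne
  rcases lt_or_gt_of_ne hne with h | h
  · exact (hmono h).ne (congrArg f hmn)
  · exact (hmono h).ne (congrArg f hmn.symm)

lemma one_le_rank_of_one_lt_valuation_double {v : Valuation k Γ₀} [NeZero (2 : k)] (h2 : v 2 < 1)
    {a₂ a₄ a₆ : k} (ha₂ : v a₂ ≤ 1) (ha₄ : v a₄ ≤ 1) (ha₆ : v a₆ ≤ 1)
    (hE : (⟨0, a₂, 0, a₄, a₆⟩ : WeierstrassCurve k).Δ ≠ 0) {x y : k} (hy : y ≠ 0)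
    (h : y ^ 2 = x ^ 3 + a₂ * x ^ 2 + a₄ * x + a₆)
    (hx : 1 < v (((3 * x ^ 2 + 2 * a₂ * x + a₄) / (2 * y)) ^ 2 - a₂ - 2 * x)) :
    1 ≤ Module.rank ℤ (WeierstrassCurve.toAffine ⟨0, a₂, 0, a₄, a₆⟩).Point := by
  have hns : (WeierstrassCurve.toAffine ⟨0, a₂, 0, a₄, a₆⟩).Nonsingular x y := by
    rw [← WeierstrassCurve.Affine.equation_iff_nonsingular_of_Δ_ne_zero hE,
      WeierstrassCurve.Affine.equation_iff]
    simpa using h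
  obtain ⟨x', y', h', -, rfl⟩ := add_self_some hns hy
  exact one_le_rank_of_not_isOfFinAddOrder
    (not_isOfFinAddOrder_of_lt_add_self (P := .some _ _ h') (xValuation v)
      (xValuation_lt_xValuation_add_self h2 ha₂ ha₄ ha₆) hx)

end InfiniteOrder

section NumberField

open NumberField

lemma not_isUnit_two (k : Type*) [Field k] [NumberField k] : ¬ IsUnit (2 : 𝓞 k) := by
  intro h
  have h2 : algebraMap ℤ (𝓞 k) 2 = 2 := map_ofNat (algebraMap ℤ (𝓞 k)) 2
  rw [← h2] at h
  exact absurd (isUnit_of_map_unit (algebraMap ℤ (𝓞 k)) 2 h) (by decide)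

lemma exists_valuation_two_lt_one (k : Type*) [Field k] [NumberField k] :
    ∃ v : Valuation k (WithZero (Multiplicative ℤ)), v 2 < 1 ∧ ∀ n : ℤ, v n ≤ 1 := by
  obtain ⟨M, hM, h2⟩ := exists_max_ideal_of_mem_nonunits (not_isUnit_two k)
  let P : IsDedekindDomain.HeightOneSpectrum (𝓞 k) :=
    ⟨M, hM.isPrime, fun h0 => two_ne_zero (α := 𝓞 k) (by rwa [h0] at h2)⟩
  refine ⟨P.valuation k, ?_, fun n => ?_⟩
  · have h := (P.valuation_lt_one_iff_mem (K := k) 2).2 h2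
    exact (map_ofNat (algebraMap (𝓞 k) k) 2) ▸ h
  · have h := P.valuation_le_one (K := k) (n : 𝓞 k)
    exact (map_intCast (algebraMap (𝓞 k) k) n) ▸ h

end NumberField

/-! ### The fibers of positive rank -/

section Jacobians

variable {k : Type*} [Field k] {Γ₀ : Type*} [LinearOrderedCommGroupWithZero Γ₀]
  {v : Valuation k Γ₀}

lemma Δ_quadricJacobian (a b c : k) : (quadricJacobian a b c).Δ =
    16 * (a * b * c * ((a - b) * (b - c) * (c - a))) ^ 2 := by
  simp only [quadricJacobian, WeierstrassCurve.Δ, WeierstrassCurve.b₂, WeierstrassCurve.b₄,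
    WeierstrassCurve.b₆, WeierstrassCurve.b₈]
  ring

lemma Δ_cubicJacobian (e t : k) : (cubicJacobian e t).Δ = -432 * (t ^ 2 - e ^ 3) ^ 2 := by
  simp only [cubicJacobian, WeierstrassCurve.Δ, WeierstrassCurve.b₂, WeierstrassCurve.b₄,
    WeierstrassCurve.b₆, WeierstrassCurve.b₈]
  ring

variable [DecidableEq k]

/-- The double of the point `(0, a b c)` has the `x`-coordinate
`((a + b + c) / 2)² - (a b + b c + c a)`, which is not integral at a place above `2`. -/
lemma one_le_rank_quadricJacobian [CharZero k] (h2 : v 2 < 1) {a b c : k} (ha : v a ≤ 1)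
    (hb : v b ≤ 1) (hc : v c ≤ 1) (hsum : v (a + b + c) = 1) (habc : a * b * c ≠ 0)
    (hE : (quadricJacobian a b c).Δ ≠ 0) :
    1 ≤ Module.rank ℤ (quadricJacobian a b c).toAffine.Point := by
  have h20 : 0 < v 2 := v.pos_iff.2 two_ne_zero
  have hab : v (a * b) ≤ 1 := by rw [map_mul]; exact mul_le_one' ha hb
  have hbc : v (b * c) ≤ 1 := by rw [map_mul]; exact mul_le_one' hb hc
  have hac : v (a * c) ≤ 1 := by rw [map_mul]; exact mul_le_one' ha hc
  have h3 : v (a * b * c) ≤ 1 := by rw [map_mul]; exact mul_le_one' hab hc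
  have ha₂ : v (a * b + b * c + a * c) ≤ 1 := v.map_add_le (v.map_add_le hab hbc) hac
  have hlt : 1 < v (((a + b + c) / 2) ^ 2) := by
    rw [map_pow, map_div₀, hsum]
    exact one_lt_pow₀ ((one_lt_div₀ h20).2 h2) two_ne_zero
  refine one_le_rank_of_one_lt_valuation_double h2 ha₂ ?_ ?_ hE (x := 0) habc (by ring) ?_
  · rw [map_mul, hsum, mul_one]
    exact h3
  · rw [map_pow]
    exact pow_le_one' h3 2
  · have hx : ((3 * (0 : k) ^ 2 + 2 * (a * b + b * c + a * c) * 0 + a * b * c * (a + b + c)) /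
        (2 * (a * b * c))) ^ 2 - (a * b + b * c + a * c) - 2 * 0 =
        ((a + b + c) / 2) ^ 2 - (a * b + b * c + a * c) := by
      have hslope : (3 * (0 : k) ^ 2 + 2 * (a * b + b * c + a * c) * 0 + a * b * c * (a + b + c)) /
          (2 * (a * b * c)) = (a + b + c) / 2 := by
        rw [div_eq_div_iff (mul_ne_zero two_ne_zero habc) two_ne_zero]
        ring
      rw [hslope]
      ring
    rw [hx, v.map_sub_eq_of_lt_left (ha₂.trans_lt hlt)]
    exact hlt

/-- The double of the point `(e, t)` has the `x`-coordinate `(3 e² / (2 t))² - 2 e`, which is not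
integral at a place above `2`. -/
lemma one_le_rank_cubicJacobian [CharZero k] (h2 : v 2 < 1) {e t : k} (he : v e = 1)
    (ht : v t ≤ 1) (ht0 : t ≠ 0) (hE : (cubicJacobian e t).Δ ≠ 0) :
    1 ≤ Module.rank ℤ (cubicJacobian e t).toAffine.Point := by
  have h2t : v (2 * t) < 1 := by
    rw [map_mul]
    exact (mul_le_of_le_one_right' ht).trans_lt h2
  have h2e : v (2 * e) ≤ 1 := by
    rw [map_mul, he, mul_one]
    exact h2.le
  have h2t0 : 0 < v (2 * t) := v.pos_iff.2 (mul_ne_zero two_ne_zero ht0)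
  have hlt : 1 < v ((3 * e ^ 2 / (2 * t)) ^ 2) := by
    rw [map_pow, map_div₀, map_mul v 3, map_pow, he, valuation_three h2, one_pow, one_mul]
    exact one_lt_pow₀ ((one_lt_div₀ h2t0).2 h2t) two_ne_zero
  refine one_le_rank_of_one_lt_valuation_double h2 (by simp) (by simp) ?_ hE (x := e) ht0
    (by ring) ?_
  · refine v.map_sub_le ?_ ?_ <;> rw [map_pow]
    · exact pow_le_one' ht 2
    · rw [he, one_pow]
  · rw [show (3 * e ^ 2 + 2 * 0 * e + 0) = 3 * e ^ 2 by ring, sub_zero,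
      v.map_sub_eq_of_lt_left (h2e.trans_lt hlt)]
    exact hlt

end Jacobians

section Families

variable {k : Type*} [Field k]

lemma isAdmissible_natCast [CharZero k] {r : ℕ} (hr : r ≠ 0) {n : ℕ} {f : Fin (n + 1) → ℕ}
    (hf : Function.Injective f) : IsAdmissible r (fun i => (f i : k)) := fun i j hij h =>
  hij (hf (Nat.pow_left_injective hr (Nat.cast_injective (R := k) (by simpa using h))))

/-- The coordinate that is equal to `1` distinguishes the points of the family. -/
lemma infinite_positiveRankLocus [CharZero k] {r s n : ℕ} {F : ℕ → Fin (n + 1) → ℕ}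
    (hF : Function.Injective F) {j : Fin (n + 1)} (hj : ∀ m, F m j = 1)
    (h : ∀ m, IsAdmissible r (fun i => (F m i : k)) ∧
      IsEllipticCurveOfPositiveRank (fiberIdeal r s fun i => (F m i : k))) :
    (positiveRankLocus k r s n).Infinite := by
  have h0 : ∀ m, (fun i => (F m i : k)) ≠ 0 := fun m h0 => by
    simpa [hj] using congrFun h0 j
  refine Set.infinite_of_injective_forall_mem
    (f := fun m => Projectivization.mk k (fun i => (F m i : k)) (h0 m)) (fun m m' hm => ?_)
    fun m => ⟨_, h0 m, rfl, h m⟩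
  obtain ⟨c, hc⟩ := (Projectivization.mk_eq_mk_iff' k _ _ _ _).1 hm
  have hc1 : c = 1 := by simpa [hj] using congrFun hc j
  refine hF (funext fun i => ?_)
  have hi := congrFun hc i
  rw [hc1, one_smul] at hi
  exact (Nat.cast_injective hi).symm

variable [NumberField k]

lemma isEllipticCurveOfPositiveRank_space {r : ℕ} {α : Fin (3 + 1) → k} (h : IsAdmissible r α)
    (h3 : α 3 ^ r = 0) {l m n : ℤ} (h0 : α 0 ^ r = l) (h1 : α 1 ^ r = m) (h2 : α 2 ^ r = n)
    (hodd : Odd (l + m + n)) : IsEllipticCurveOfPositiveRank (fiberIdeal r 2 α) := by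
  classical
  obtain ⟨v, hv2, hv⟩ := exists_valuation_two_lt_one k
  have hab : (l : k) ≠ m := by rw [← h0, ← h1]; exact h 0 1 (by decide)
  have hbc : (m : k) ≠ n := by rw [← h1, ← h2]; exact h 1 2 (by decide)
  have hca : (n : k) ≠ l := by rw [← h0, ← h2]; exact h 2 0 (by decide)
  have hl : (l : k) ≠ 0 := by rw [← h0, ← h3]; exact h 0 3 (by decide)
  have hm : (m : k) ≠ 0 := by rw [← h1, ← h3]; exact h 1 3 (by decide)
  have hn : (n : k) ≠ 0 := by rw [← h2, ← h3]; exact h 2 3 (by decide)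
  have habc : (l * m * n : k) ≠ 0 := mul_ne_zero (mul_ne_zero hl hm) hn
  have hΔ : (quadricJacobian (l : k) m n).Δ ≠ 0 := by
    rw [Δ_quadricJacobian]
    exact mul_ne_zero (by norm_num) (pow_ne_zero 2 (mul_ne_zero habc (mul_ne_zero
      (mul_ne_zero (sub_ne_zero.2 hab) (sub_ne_zero.2 hbc)) (sub_ne_zero.2 hca))))
  refine ⟨isSmoothCurveOfGenus_fiberIdeal_space h, quadricJacobian l m n,
    ⟨isUnit_iff_ne_zero.2 hΔ⟩, ?_, ?_⟩
  · rw [fiberIdeal_space, h0, h1, h2, h3, zero_sub, sub_zero]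
    exact isIsomorphic_quadricJacobian hab hbc hca habc
  · have hsum : v (l + m + n) = 1 := by
      obtain ⟨d, hd⟩ := hodd
      have hd' : (l + m + n : k) = 1 + 2 * d := by
        rw [add_comm 1]
        exact_mod_cast hd
      rw [hd']
      refine v.map_one_add_of_lt ?_
      rw [map_mul]
      exact (mul_le_of_le_one_right' (hv d)).trans_lt hv2
    convert one_le_rank_quadricJacobian hv2 (hv l) (hv m) (hv n) hsum habc hΔ

/-- The coefficients of the cubic are `2 d - 1`, `-2 d`, `1`. The parity of the second one makes the
constants `e` and `t` of the Weierstrass equation integers, and `e` odd. -/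
lemma isEllipticCurveOfPositiveRank_plane {r : ℕ} {α : Fin (2 + 1) → k} (h : IsAdmissible r α)
    (h0 : α 0 ^ r = 0) (h1 : α 1 ^ r = 1) {d : ℤ} (hd : 2 ≤ d) (h2 : α 2 ^ r = 2 * d) :
    IsEllipticCurveOfPositiveRank (fiberIdeal r 3 α) := by
  classical
  obtain ⟨v, hv2, hv⟩ := exists_valuation_two_lt_one k
  obtain ⟨e, he⟩ : ∃ e : ℤ, e = 4 * d ^ 2 - 2 * d + 1 := ⟨_, rfl⟩
  obtain ⟨t, ht⟩ : ∃ t : ℤ, t = -((4 * d - 1) * (2 * d + 1) * (d - 1)) := ⟨_, rfl⟩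
  have hek : (e : k) = 4 * d ^ 2 - 2 * d + 1 := by exact_mod_cast congrArg (Int.cast (R := k)) he
  have htk : (t : k) = -((4 * d - 1) * (2 * d + 1) * (d - 1)) := by
    exact_mod_cast congrArg (Int.cast (R := k)) ht
  have he0 : (e : k) ≠ 0 := Int.cast_ne_zero.2 (by nlinarith)
  have ht0 : (t : k) ≠ 0 := Int.cast_ne_zero.2 (by
    rw [ht]
    exact neg_ne_zero.2 (mul_ne_zero (mul_ne_zero (by lia) (by lia)) (by lia)))
  have hd0 : (d : k) ≠ 0 := Int.cast_ne_zero.2 (by lia)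
  have hd1 : (2 * d - 1 : k) ≠ 0 := by
    exact_mod_cast (Int.cast_ne_zero (α := k)).2 (by lia : 2 * d - 1 ≠ 0)
  have hΔ : (cubicJacobian (e : k) t).Δ ≠ 0 := by
    rw [Δ_cubicJacobian, show (t ^ 2 - e ^ 3 : k) = -27 * (d * (2 * d - 1)) ^ 2 by
      rw [hek, htk]; ring]
    exact mul_ne_zero (by norm_num) (pow_ne_zero 2 (mul_ne_zero (by norm_num)
      (pow_ne_zero 2 (mul_ne_zero hd0 hd1))))
  refine ⟨isSmoothCurveOfGenus_fiberIdeal_plane h (by norm_num) (by norm_num),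
    cubicJacobian e t, ⟨isUnit_iff_ne_zero.2 hΔ⟩, ?_, ?_⟩
  · rw [fiberIdeal_plane, h0, h1, h2]
    refine isIsomorphic_cubicJacobian (by ring) ?_ ?_ ?_ he0 ht0
    · exact mul_ne_zero (mul_ne_zero hd1 (by simpa using hd0)) (by simp)
    · rw [hek]
      ring
    · rw [htk]
      ring
  · have hve : v e = 1 := by
      rw [show (e : k) = 1 + 2 * (2 * d ^ 2 - d : ℤ) by rw [hek]; push_cast; ring]
      refine v.map_one_add_of_lt ?_
      rw [map_mul]
      exact (mul_le_of_le_one_right' (hv _)).trans_lt hv2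
    convert one_le_rank_cubicJacobian hv2 hve (hv t) ht0 hΔ

/-- The family `[1 : 2 : 2 m + 4 : 0]`, for which exactly one of the first three coordinates
is odd. -/
lemma infinite_positiveRankLocus_space {r : ℕ} (hr : r ≠ 0) :
    (positiveRankLocus k r 2 3).Infinite := by
  refine infinite_positiveRankLocus (F := fun t => ![1, 2, 2 * t + 4, 0]) (j := 0)
    (fun t t' h => ?_) (fun _ => rfl) fun t => ?_
  · simpa using congrFun h 2
  · have hadm : IsAdmissible r (fun i => ((![1, 2, 2 * t + 4, 0] : Fin (3 + 1) → ℕ) i : k)) := by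
      refine isAdmissible_natCast hr fun i j hij => ?_
      fin_cases i <;> fin_cases j <;> simp at hij ⊢
    refine ⟨hadm, isEllipticCurveOfPositiveRank_space hadm (by simp [hr]) (l := 1) (m := 2 ^ r)
      (n := (2 * t + 4) ^ r) (by simp) (by simp) (by simp) ?_⟩
    rw [add_assoc]
    refine odd_one.add_even (Even.add (even_two.pow_of_ne_zero hr) (Even.pow_of_ne_zero ?_ hr))
    exact ⟨t + 2, by ring⟩

/-- The family `[0 : 1 : 2 m + 4]`, for which the last coordinate is even. It is not `2`, because the
constant `t` of the Weierstrass equation vanishes for `(0, 1, 2)` and `r = 1`. -/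
lemma infinite_positiveRankLocus_plane {r : ℕ} (hr : r ≠ 0) :
    (positiveRankLocus k r 3 2).Infinite := by
  refine infinite_positiveRankLocus (F := fun t => ![0, 1, 2 * t + 4]) (j := 1)
    (fun t t' h => ?_) (fun _ => rfl) fun t => ?_
  · simpa using congrFun h 2
  · have hadm : IsAdmissible r (fun i => ((![0, 1, 2 * t + 4] : Fin (2 + 1) → ℕ) i : k)) := by
      refine isAdmissible_natCast hr fun i j hij => ?_
      fin_cases i <;> fin_cases j <;> simp at hij ⊢
    have hpos : (1 : ℤ) ≤ (2 * t + 4) ^ (r - 1) := one_le_pow₀ (by lia)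
    refine ⟨hadm, isEllipticCurveOfPositiveRank_plane hadm (by simp [hr]) (by simp)
      (d := (t + 2) * (2 * t + 4) ^ (r - 1)) (by nlinarith) ?_⟩
    obtain ⟨r, rfl⟩ := Nat.exists_eq_succ_of_ne_zero hr
    simp [pow_succ]
    ring

end Families

end LowGenusFibers

end

theorem theorem4p5 {k : Type*} [Field k] [NumberField k] (r : ℕ) (hr : 2 ≤ r) :
    -- s = 2, n = 2
    (∀ α : Fin (2 + 1) → k, LowGenusFibers.IsAdmissible r α →
      LowGenusFibers.IsConic (LowGenusFibers.fiberIdeal r 2 α) ∧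
      LowGenusFibers.IsSmoothCurveOfGenus (LowGenusFibers.fiberIdeal r 2 α) 0 ∧
      Projectivization.mk k (fun _ : Fin (2 + 1) => (1 : k)) (fun h => one_ne_zero (congrFun h 0)) ∈
        LowGenusFibers.points (LowGenusFibers.fiberIdeal r 2 α) k ∧
      (LowGenusFibers.points (LowGenusFibers.fiberIdeal r 2 α) k).Infinite) ∧
    -- s = 2, n = 3
    ((∀ α : Fin (3 + 1) → k, LowGenusFibers.IsAdmissible r α →
        LowGenusFibers.IsSmoothCurveOfGenus (LowGenusFibers.fiberIdeal r 2 α) 1) ∧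
      (LowGenusFibers.positiveRankLocus k r 2 3).Infinite) ∧
    -- s = 3, n = 2
    ((∀ α : Fin (2 + 1) → k, LowGenusFibers.IsAdmissible r α →
        LowGenusFibers.IsSmoothCurveOfGenus (LowGenusFibers.fiberIdeal r 3 α) 1) ∧
      (LowGenusFibers.positiveRankLocus k r 3 2).Infinite) := by
  have hr0 : r ≠ 0 := by lia
  refine ⟨fun α h => ⟨LowGenusFibers.isConic_fiberIdeal h,
      LowGenusFibers.isSmoothCurveOfGenus_fiberIdeal_plane h le_rfl (by norm_num), ?_,
      LowGenusFibers.infinite_points_conic h⟩,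
    ⟨fun α h => LowGenusFibers.isSmoothCurveOfGenus_fiberIdeal_space h,
      LowGenusFibers.infinite_positiveRankLocus_space hr0⟩,
    ⟨fun α h => LowGenusFibers.isSmoothCurveOfGenus_fiberIdeal_plane h (by norm_num)
      (by norm_num), LowGenusFibers.infinite_positiveRankLocus_plane hr0⟩⟩
  rw [LowGenusFibers.mk_mem_points_fiberIdeal_plane]
  ring
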